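/- **Setting.** A *scheme* consists of four closed disks (2-cells), whose boundary circles are divided into equal arcs (sides) labelled by a cyclic word in the letters $A,A',B,B',C,C'$ and their inverses, each letter occurring twice in total. For a set $E$ of letters let $M_E$ be the quotient of the disjoint union of the four disks by gluing, with the prescribed directions, sides that carry the same letter of $E$. Let $\widetilde P$ be $M_E$ for $E$ the set of all six letters, and let $X$ be the quotient in which moreover the edges $A$ and $A'$, $B$ and $B'$, $C$ and $C'$ are identified (the loops of double points). So $X$ is a CW-complex with one 0-cell, three 1-cells $A,B,C$ and four 2-cells; its 1-skeleton is the image of the boundary circles of the four disks; and $\widetilde P\to X$ is the immersion. The words are * Boy's surface: $A'$; $B'$; $C'$; $A\,C'^{-1}\,B\,C\,B'^{-1}\,A\,B\,A'^{-1}\,C$. * Girl's surface: $A'$; $B'$; $A\,C'^{-1}\,C'^{-1}\,B\,C$; $C^{-1}\,A'\,B^{-1}\,A^{-1}\,B'$. Let $P,S$ be topological spaces (for example the projective plane and $\mathbb R^3$) and let $f:P\to S$ be a map that is the Boy's (respectively Girl's) immersion up to homeomorphism: there are a homeomorphism $\widetilde P\cong P$ and a topological embedding $X\hookrightarrow S$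 through which $f$ corresponds to $\widetilde P\to X$. A *representation* of $P$ is a quotient map $q:D^2\to P$ from the closed unit disk such that $q(z)=q(w)$ if and only if $z=w$, or $|z|=1$ and $w=-z$, and such that $f(q(\partial D^2))$ lies in the 1-skeleton of the Boy's (Girl's) surface. **Planar models.** For the Boy's surface let $M=M_{\{A',B',C'\}}$: the three monogons are glued to the nonagon, leaving a hexagon with boundary word $A\,B\,C\,A\,B\,C$. For the Girl's surface let $M=M_{\{A,A',B,B',C\}}$: all sides but $C'$ are glued, leaving a bigon whose two sides both carry $C'$ in the same direction around the boundary. Let $\pi:M\to P$ be the map that glues the remaining sides. **Lemma.** In each of the two cases there is a homeomorphism $\varphi:D^2\to M$ that carries the six (respectively two) equal arcs of $\partial D^2$ in order, linearly in the angle and the side parameter, onto the free sides of $M$, such that $\pi\circ\varphi$ is a representation of $P$. This representation is unique up to homeomorphism: for every representation $q:D^2\to P$ there is a homeomorphism $h:D^2\to D^2$ with $q=\pi\circ\varphi\circ h$. -/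

import Mathlib

namespace TripleImmersion

/-- The closed unit disk. -/
abbrev Disk : Type := Metric.closedBall (0 : ℂ) 1

/-- The boundary point of the disk at `s` full turns. -/
noncomputable def Disk.turn (s : ℝ) : Disk :=
  ⟨(Circle.exp (2 * Real.pi * s) : ℂ), mem_closedBall_zero_iff.2 (Circle.norm_coe _).le⟩

/-- The three loops of double points of the immersed surface, i.e. its 1-cells. -/
inductive DoubleLoop
  | A | B | C

/-- The six 1-cells of the induced cell structure of the projective plane: every loop of
double points is covered twice. -/
inductive Edge
  | A | A' | B | B' | C | C'

/-- The loop of double points covered by an edge. -/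
def Edge.loop : Edge → DoubleLoop
  | .A | .A' => .A
  | .B | .B' => .B
  | .C | .C' => .C

/-- The boundary words of four polygons. A letter is an edge together with the direction in
which it is traversed (`true`: along the edge, `false`: against it). -/
abbrev Scheme : Type := Fin 4 → List (Edge × Bool)

/-- The Boy's surface. With the angles at the triple point numbered from 1 to 12, the words are
`9 A' 9`, `3 B' 3`, `5 C' 5` and
`1 A 6 C' 8 B 11 C 2 B' 4 A 7 B 10 A' 12 C 1`. -/
def boy : Scheme :=
  ![[(.A', true)],
    [(.B', true)],
    [(.C', true)],
    [(.A, true), (.C', false), (.B, true), (.C, true), (.B', false), (.A, true), (.B, true),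
      (.A', false), (.C, true)]]

/-- The Girl's surface. With the same numbering of the angles, the words are
`9 A' 9`, `3 B' 3`, `1 A 6 C' 5 C' 8 B 11 C 1` and `2 C 12 A' 10 B 7 A 4 B' 2`. -/
def girl : Scheme :=
  ![[(.A', true)],
    [(.B', true)],
    [(.A, true), (.C', false), (.C', false), (.B, true), (.C, true)],
    [(.C, false), (.A', true), (.B, false), (.A, false), (.B', true)]]

/-- Four disjoint closed disks, the closed 2-cells before gluing. -/
abbrev Polygons : Type := Σ _ : Fin 4, Disk

namespace Scheme

variable (K : Scheme)

/-- The edge written on side `k` of polygon `i`. -/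
def edge (i : Fin 4) (k : Fin (K i).length) : Edge := ((K i).get k).1

/-- The polygon `i` with `n` sides is the disk whose boundary circle is cut into `n` equal arcs;
`sidePoint i k t` is the point on side `k` that has parameter `t` in the direction of the edge
written on that side. -/
noncomputable def sidePoint (i : Fin 4) (k : Fin (K i).length) (t : unitInterval) : Polygons :=
  ⟨i, Disk.turn (((k : ℕ) + (if ((K i).get k).2 then (t : ℝ) else 1 - (t : ℝ))) /
    (K i).length)⟩

/-- Sides carrying the same edge, where this edge belongs to `E`, are glued. -/
def EdgeGlue (E : Set Edge) (x y : Polygons) : Prop :=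
  ∃ (i : Fin 4) (k : Fin (K i).length) (j : Fin 4) (l : Fin (K j).length) (t : unitInterval),
    K.edge i k = K.edge j l ∧ K.edge i k ∈ E ∧ x = K.sidePoint i k t ∧ y = K.sidePoint j l t

/-- Sides covering the same loop of double points are glued. -/
def LoopGlue (x y : Polygons) : Prop :=
  ∃ (i : Fin 4) (k : Fin (K i).length) (j : Fin 4) (l : Fin (K j).length) (t : unitInterval),
    (K.edge i k).loop = (K.edge j l).loop ∧ x = K.sidePoint i k t ∧ y = K.sidePoint j l t

/-- The polygons glued along the edges in `E` only, with the quotient topology. -/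
def Glued (E : Set Edge) : Type := Quot (K.EdgeGlue E)

instance (E : Set Edge) : TopologicalSpace (K.Glued E) :=
  inferInstanceAs (TopologicalSpace (Quot (K.EdgeGlue E)))

/-- The class of a point of the polygons. -/
def Glued.mk (E : Set Edge) (x : Polygons) : K.Glued E := Quot.mk _ x

/-- The closed surface that is immersed: the polygons glued along all six edges. -/
abbrev Plane : Type := K.Glued Set.univ

/-- The gluing of the remaining edges. -/
def glueRest (E : Set Edge) : K.Glued E → K.Plane :=
  Quot.map id fun _ _ ⟨i, k, j, l, t, h, _, hx, hy⟩ =>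
    ⟨i, k, j, l, t, h, Set.mem_univ _, hx, hy⟩

/-- The immersed surface: a complex with one 0-cell, the 1-cells `A`, `B`, `C` and four 2-cells. -/
def Surface : Type := Quot K.LoopGlue

instance : TopologicalSpace K.Surface := inferInstanceAs (TopologicalSpace (Quot K.LoopGlue))

/-- The 1-skeleton of the immersed surface: the image of the boundaries of the polygons. -/
def oneSkeleton : Set K.Surface := Quot.mk K.LoopGlue '' {x | ‖(x.2 : ℂ)‖ = 1}

/-- The immersion: it glues the two edges over each loop of double points. -/
def immersion : K.Plane → K.Surface :=
  Quot.map id fun _ _ ⟨i, k, j, l, t, h, _, hx, hy⟩ =>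
    ⟨i, k, j, l, t, congrArg Edge.loop h, hx, hy⟩

end Scheme

/-- A cell structure of type `K` on a map `f : P → S` (for instance an immersion into `ℝ³`):
up to homeomorphisms of the domain and of the image, `f` is the immersion described by `K`. -/
structure CellStructure (K : Scheme) {P S : Type*} [TopologicalSpace P] [TopologicalSpace S]
    (f : P → S) where
  domain : K.Plane ≃ₜ P
  image : K.Surface → S
  isEmbedding_image : Topology.IsEmbedding image
  comm : ∀ x, f (domain x) = image (K.immersion x)

/-- The cell structure of the immersion described by `K`. -/
def CellStructure.standard (K : Scheme) : CellStructure K K.immersion :=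
  ⟨Homeomorph.refl _, id, Topology.IsEmbedding.id, fun _ => rfl⟩

namespace CellStructure

variable {K : Scheme} {P S : Type*} [TopologicalSpace P] [TopologicalSpace S] {f : P → S}

/-- The 1-skeleton of the image of `f`. -/
def oneSkeleton (c : CellStructure K f) : Set S := c.image '' K.oneSkeleton

/-- The map from the polygons glued along `E` to `P`. -/
def proj (c : CellStructure K f) (E : Set Edge) : K.Glued E → P := c.domain ∘ K.glueRest E

/-- A representation of `P` as the disk with opposite boundary points glued, such that the
boundary is mapped into the 1-skeleton of the image of `f`. -/
structure IsRepresentation (c : CellStructure K f) (q : Disk → P) : Prop where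
  isQuotientMap : Topology.IsQuotientMap q
  eq_iff : ∀ z w : Disk, q z = q w ↔ z = w ∨ ‖(z : ℂ)‖ = 1 ∧ (w : ℂ) = -(z : ℂ)
  boundary : ∀ z : Disk, ‖(z : ℂ)‖ = 1 → f (q z) ∈ c.oneSkeleton

end CellStructure

/-- The planar model of the Boy's surface: the three monogons are glued to the nonagon. -/
abbrev boyGlued : Set Edge := {.A', .B', .C'}

/-- The free sides of the nonagon, which are the sides `A`, `B`, `C`, `A`, `B`, `C` of the
hexagon, in cyclic order. -/
def boySide : Fin 6 → Fin (boy 3).length := (![0, 2, 3, 5, 6, 8] : Fin 6 → Fin 9)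

/-- The planar model of the Girl's surface: all edges but `C'` are glued. -/
abbrev girlGlued : Set Edge := {.A, .A', .B, .B', .C}

/-- The two free sides, both labelled by the remaining edge. -/
def girlSide : Fin 2 → Fin (girl 2).length := (![1, 2] : Fin 2 → Fin 5)

end TripleImmersion

namespace TripleImmersion

open Set Topology Filter
open scoped unitInterval

/-! ### Polar coordinates and horocycles on the disk -/

/-! Existence is planar surgery. In the Boy's surface the sides of the nonagon that carry `A'`,
`B'`, `C'` are closed up to loops and filled by the monogons. In the Girl's surface the monogons
fill two loops of the second pentagon, and the resulting triangle fills the loop made of three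
consecutive sides of the first pentagon. Both are instances of
`IsCollapse.exists_isPetalDecomposition`: a monotone circle map of degree one that collapses
disjoint arcs splits the disk into a core and petals, each petal touching the unit circle at one
point only. Explicit piecewise linear collapses carry the free sides linearly onto equal arcs. The
map from the polygons to the disk identifies exactly what the gluing along `E` identifies, so
compactness gives the homeomorphism `φ`. Opposite free arcs carry the same edge in the same
direction, so gluing them is gluing antipodes.

For uniqueness let `q` be a representation and `q₀` the one built. The closed curve `q(∂D)` lies in
the 1-skeleton, hence in the image under `q₀` of the unit circle and of the petal boundaries, and
its complement `q(int D)` is connected. A petal meets the rest of the 1-skeleton at its base point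
only. If the curve entered a petal boundary off the base point, it would lie in that boundary,
because a circle minus a point is connected. It would then be all of it, by the one-dimensional
Borsuk–Ulam argument of `exists_eq_of_injective`. But a petal boundary separates the plane
(`boundary_subset_of_petal`), a contradiction. For the Girl's surface this is applied to the inner
petals and then to the outer one.

So `q(∂D)` lies in `q₀(∂D)`, and equality follows from the same argument. Over the open disk `q`
lifts uniquely through `q₀`; the closure of the graph of this lift is again a graph
(`exists_continuous_lift`), and the lifts in both directions are inverse homeomorphisms. -/

theorem Disk.coe_turn (s : ℝ) : (Disk.turn s : ℂ) = (Circle.exp (2 * Real.pi * s) : ℂ) := rfl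

@[simp]
theorem Disk.norm_turn (s : ℝ) : ‖(Disk.turn s : ℂ)‖ = 1 := Circle.norm_coe _

theorem Disk.norm_le_one (z : Disk) : ‖(z : ℂ)‖ ≤ 1 := mem_closedBall_zero_iff.1 z.2

theorem Disk.continuous_turn : Continuous Disk.turn :=
  Continuous.subtype_mk (by fun_prop) _

theorem Disk.turn_eq_turn {s s' : ℝ} : Disk.turn s = Disk.turn s' ↔ ∃ m : ℤ, s = s' + m := by
  rw [Subtype.ext_iff, Disk.coe_turn, Disk.coe_turn, Circle.coe_inj, Circle.exp_eq_exp]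
  refine exists_congr fun m => ⟨fun h => ?_, fun h => by rw [h]; ring⟩
  have : (2 * Real.pi) * s = (2 * Real.pi) * (s' + m) := by rw [h]; ring
  exact mul_left_cancel₀ Real.two_pi_pos.ne' this

theorem Disk.turn_add_int (s : ℝ) (m : ℤ) : Disk.turn (s + m) = Disk.turn s :=
  Disk.turn_eq_turn.2 ⟨m, rfl⟩

theorem Disk.turn_add_one (s : ℝ) : Disk.turn (s + 1) = Disk.turn s := by
  simpa using Disk.turn_add_int s 1

@[simp]
theorem Disk.coe_turn_zero : (Disk.turn 0 : ℂ) = 1 := by simp [Disk.coe_turn]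

@[simp]
theorem Disk.turn_one : Disk.turn 1 = Disk.turn 0 := by
  simpa using Disk.turn_add_one 0

theorem Disk.coe_turn_add_half (s : ℝ) : (Disk.turn (s + 1 / 2) : ℂ) = -(Disk.turn s : ℂ) := by
  rw [Disk.coe_turn, Disk.coe_turn, mul_add, Circle.exp_add]
  have : 2 * Real.pi * (1 / 2) = Real.pi := by ring
  rw [this]
  simp

theorem Disk.exists_turn {z : Disk} (hz : ‖(z : ℂ)‖ = 1) : ∃ s, z = Disk.turn s := by
  obtain ⟨x, hx⟩ := Circle.exp_surjective ⟨(z : ℂ), mem_sphere_zero_iff_norm.2 hz⟩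
  refine ⟨x / (2 * Real.pi), Subtype.ext ?_⟩
  rw [Disk.coe_turn, mul_div_cancel₀ _ Real.two_pi_pos.ne', hx]

theorem Disk.exists_turn_unit {z : Disk} (hz : ‖(z : ℂ)‖ = 1) :
    ∃ t : I, z = Disk.turn t := by
  obtain ⟨s, rfl⟩ := Disk.exists_turn hz
  refine ⟨⟨Int.fract s, Int.fract_nonneg s, (Int.fract_lt_one s).le⟩, ?_⟩
  exact Disk.turn_eq_turn.2 ⟨⌊s⌋, (Int.fract_add_floor s).symm⟩

/-- Complex conjugation on the disk. -/
noncomputable def Disk.conj (z : Disk) : Disk :=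
  ⟨starRingEnd ℂ z, mem_closedBall_zero_iff.2 ((RCLike.norm_conj _).trans_le z.norm_le_one)⟩

theorem Disk.continuous_conj : Continuous Disk.conj :=
  Continuous.subtype_mk (Complex.continuous_conj.comp continuous_subtype_val) _

@[simp]
theorem Disk.conj_conj (z : Disk) : z.conj.conj = z := Subtype.ext (Complex.conj_conj _)

@[simp]
theorem Disk.norm_conj (z : Disk) : ‖(z.conj : ℂ)‖ = ‖(z : ℂ)‖ := by
  simp [Disk.conj]

@[simp]
theorem Disk.conj_turn (s : ℝ) : (Disk.turn s).conj = Disk.turn (-s) := by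
  refine Subtype.ext ?_
  change starRingEnd ℂ (Disk.turn s : ℂ) = _
  rw [Disk.coe_turn, Disk.coe_turn, mul_neg, Circle.exp_neg, Circle.coe_inv_eq_conj]

/-- The point with polar coordinates `r` and `s` turns. -/
noncomputable def Disk.polar (r : I) (s : ℝ) : Disk :=
  ⟨(r : ℝ) * (Disk.turn s : ℂ), by
    rw [mem_closedBall_zero_iff, norm_mul, Disk.norm_turn, mul_one, Complex.norm_real,
      Real.norm_of_nonneg r.2.1]
    exact r.2.2⟩

theorem Disk.coe_polar (r : I) (s : ℝ) :
    (Disk.polar r s : ℂ) = (r : ℝ) * (Disk.turn s : ℂ) := rfl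

@[simp]
theorem Disk.norm_polar (r : I) (s : ℝ) : ‖(Disk.polar r s : ℂ)‖ = r := by
  rw [Disk.coe_polar, norm_mul, Disk.norm_turn, mul_one, Complex.norm_real,
      Real.norm_of_nonneg r.2.1]

@[simp]
theorem Disk.polar_one (s : ℝ) : Disk.polar 1 s = Disk.turn s :=
  Subtype.ext (by simp [Disk.coe_polar])

theorem Disk.continuous_polar : Continuous fun x : I × ℝ => Disk.polar x.1 x.2 := by
  refine Continuous.subtype_mk ?_ _
  have := Disk.continuous_turn
  fun_prop

theorem Disk.polar_eq_polar {r r' : I} {s s' : ℝ} :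
    Disk.polar r s = Disk.polar r' s' ↔ r = r' ∧ (r = 0 ∨ ∃ m : ℤ, s = s' + m) := by
  constructor
  · intro h
    have hr : r = r' := Subtype.ext (by simpa using congrArg (fun z : Disk => ‖(z : ℂ)‖) h)
    refine ⟨hr, or_iff_not_imp_left.2 fun h0 => ?_⟩
    subst hr
    have h0' : ((r : ℝ) : ℂ) ≠ 0 := by
      simpa using fun h => h0 (Subtype.ext h)
    exact Disk.turn_eq_turn.1 (Subtype.ext (mul_left_cancel₀ h0' (Subtype.ext_iff.1 h)))
  · rintro ⟨rfl, rfl | h⟩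
    · exact Subtype.ext (by simp [Disk.coe_polar])
    · exact Subtype.ext (by rw [Disk.coe_polar, Disk.coe_polar, Disk.turn_eq_turn.2 h])

theorem Disk.exists_polar (z : Disk) : ∃ (r t : I), z = Disk.polar r t := by
  by_cases hz : (z : ℂ) = 0
  · exact ⟨0, 0, Subtype.ext (by simp [Disk.coe_polar, hz])⟩
  · have hn : ‖(z : ℂ)‖ ≠ 0 := norm_ne_zero_iff.2 hz
    have h1 : ‖(z : ℂ) / ‖(z : ℂ)‖‖ = 1 := by simp [hn]
    obtain ⟨t, ht⟩ := Disk.exists_turn_unit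
      (z := ⟨(z : ℂ) / ‖(z : ℂ)‖, mem_closedBall_zero_iff.2 h1.le⟩) h1
    refine ⟨⟨‖(z : ℂ)‖, norm_nonneg _, z.norm_le_one⟩, t, Subtype.ext ?_⟩
    rw [Disk.coe_polar, ← Subtype.ext_iff.1 ht]
    have : ((‖(z : ℂ)‖ : ℝ) : ℂ) ≠ 0 := by exact_mod_cast hn
    field_simp

/-- The angle ranges over all of `ℝ`, so that functions can be given on the universal cover. The
quotient property is inherited from the compact rectangle `I × I`, whose map to the Hausdorff disk
is closed. -/
theorem Disk.isQuotientMap_polar : IsQuotientMap fun x : I × ℝ => Disk.polar x.1 x.2 := by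
  have hc : Continuous fun x : I × I => (x.1, (x.2 : ℝ)) := by fun_prop
  refine IsQuotientMap.of_comp (f := fun x : I × I => (x.1, (x.2 : ℝ))) hc
    Disk.continuous_polar ?_
  refine IsClosedMap.isQuotientMap (Disk.continuous_polar.comp hc).isClosedMap
    (Disk.continuous_polar.comp hc) fun z => ?_
  obtain ⟨r, t, rfl⟩ := z.exists_polar
  exact ⟨(r, t), rfl⟩

/-- The point at `t` turns on the horocycle of radius `r` at `1`. -/
noncomputable def Disk.horo (r t : I) : Disk :=
  ⟨1 - (r : ℝ) + (r : ℝ) * (Disk.turn t : ℂ), by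
    rw [mem_closedBall_zero_iff]
    refine (norm_add_le _ _).trans ?_
    have h : (1 : ℂ) - (r : ℝ) = ((1 - r : ℝ) : ℂ) := by push_cast; ring
    rw [norm_mul, Disk.norm_turn, h, Complex.norm_real, Complex.norm_real,
      Real.norm_of_nonneg r.2.1, Real.norm_of_nonneg (by linarith [r.2.2])]
    linarith⟩

theorem Disk.coe_horo (r t : I) :
    (Disk.horo r t : ℂ) = 1 - (r : ℝ) + (r : ℝ) * (Disk.turn t : ℂ) := rfl

@[simp]
theorem Disk.horo_one (t : I) : Disk.horo 1 t = Disk.turn t :=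
  Subtype.ext (by simp [Disk.coe_horo])

theorem Disk.continuous_horo : Continuous fun x : I × I => Disk.horo x.1 x.2 := by
  refine Continuous.subtype_mk ?_ _
  have := Disk.continuous_turn
  fun_prop

theorem Disk.horo_eq_turn_zero {r t : I} (h : r = 0 ∨ t = 0 ∨ t = 1) :
    Disk.horo r t = Disk.turn 0 := by
  refine Subtype.ext ?_
  rw [Disk.coe_horo]
  rcases h with rfl | rfl | rfl <;> simp

theorem Disk.turn_unit_eq_turn_unit {t t' : I} (h : Disk.turn t = Disk.turn t') :
    t = t' ∨ (t = 0 ∨ t = 1) ∧ (t' = 0 ∨ t' = 1) := by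
  obtain ⟨m, hm⟩ := Disk.turn_eq_turn.1 h
  have h1 := t.2.1
  have h2 := t.2.2
  have h3 := t'.2.1
  have h4 := t'.2.2
  have hm1 : (-1 : ℤ) ≤ m := by
    have : (-1 : ℝ) ≤ m := by linarith
    exact_mod_cast this
  have hm2 : m ≤ 1 := by
    have : (m : ℝ) ≤ 1 := by linarith
    exact_mod_cast this
  interval_cases m
  · right
    refine ⟨Or.inl (Subtype.ext ?_), Or.inr (Subtype.ext ?_)⟩ <;> push_cast at hm ⊢ <;> linarith
  · left
    exact Subtype.ext (by simpa using hm)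
  · right
    refine ⟨Or.inr (Subtype.ext ?_), Or.inl (Subtype.ext ?_)⟩ <;> push_cast at hm ⊢ <;> linarith

/-- The horocycles are pairwise tangent at `1` and otherwise disjoint; the degenerate parameters are
exactly those that hit `1`. -/
theorem Disk.horo_eq_horo {r r' t t' : I} (h : Disk.horo r t = Disk.horo r' t') :
    r = r' ∧ t = t' ∨ (r = 0 ∨ t = 0 ∨ t = 1) ∧ (r' = 0 ∨ t' = 0 ∨ t' = 1) := by
  have key : ∀ {r t : I}, Disk.horo r t = Disk.turn 0 → r = 0 ∨ t = 0 ∨ t = 1 := by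
    intro r t h
    have h' := Subtype.ext_iff.1 h
    rw [Disk.coe_horo, Disk.coe_turn_zero] at h'
    have h2 : ((r : ℝ) : ℂ) * ((Disk.turn t : ℂ) - 1) = 0 := by linear_combination h'
    rcases mul_eq_zero.1 h2 with h3 | h3
    · exact Or.inl (Subtype.ext (by exact_mod_cast h3))
    · have h4 : Disk.turn t = Disk.turn (0 : I) :=
        Subtype.ext (by simpa [sub_eq_zero] using h3)
      rcases Disk.turn_unit_eq_turn_unit h4 with h5 | h5
      · exact Or.inr (Or.inl h5)
      · exact Or.inr h5.1
  by_cases h0 : Disk.horo r t = Disk.turn 0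
  · exact Or.inr ⟨key h0, key (h ▸ h0)⟩
  left
  have hsq : ∀ s : ℝ, (Disk.turn s : ℂ).re ^ 2 + (Disk.turn s : ℂ).im ^ 2 = 1 := by
    intro s
    have := Disk.norm_turn s
    rw [← sq_eq_sq₀ (norm_nonneg _) zero_le_one, ← Complex.normSq_eq_norm_sq,
      Complex.normSq_apply] at this
    linarith
  have hre := congrArg Complex.re (Subtype.ext_iff.1 h)
  have him := congrArg Complex.im (Subtype.ext_iff.1 h)
  simp only [Disk.coe_horo, Complex.add_re, Complex.sub_re, Complex.one_re, Complex.ofReal_re,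
    Complex.re_ofReal_mul, Complex.add_im, Complex.sub_im, Complex.one_im, Complex.ofReal_im,
    Complex.im_ofReal_mul] at hre him
  have e1 := hsq t
  have e2 := hsq t'
  set a := (Disk.turn t : ℂ).re
  set b := (Disk.turn t : ℂ).im
  set a' := (Disk.turn t' : ℂ).re
  set b' := (Disk.turn t' : ℂ).im
  -- For a point `z` of the horocycle of radius `r`, `|z - 1|² = 2r(1 - Re z)`. This determines `r`
  -- unless `Re z = 1`.
  have h1 : (r : ℝ) * ((r : ℝ) * (a - 1)) = r' * ((r : ℝ) * (a - 1)) := by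
    have e3 : (r : ℝ) * (a - 1) = r' * (a' - 1) := by linarith
    have e4 : (r : ℝ) * b = r' * b' := by linarith
    have e5 : (r : ℝ) ^ 2 * (2 * (a - 1)) = r' ^ 2 * (2 * (a' - 1)) := by
      have e6 : (a - 1) ^ 2 + b ^ 2 = -(2 * (a - 1)) := by linear_combination e1
      have e7 : (a' - 1) ^ 2 + b' ^ 2 = -(2 * (a' - 1)) := by linear_combination e2
      have e8 : ((r : ℝ) * (a - 1)) ^ 2 + ((r : ℝ) * b) ^ 2
          = (r' * (a' - 1)) ^ 2 + (r' * b') ^ 2 := by rw [e3, e4]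
      linear_combination -e8 + (r : ℝ) ^ 2 * e6 - (r' : ℝ) ^ 2 * e7
    linear_combination e5 / 2 - (r' : ℝ) * e3
  have hne : (r : ℝ) * (a - 1) ≠ 0 := by
    intro h2
    refine h0 (Disk.horo_eq_turn_zero ?_)
    rcases mul_eq_zero.1 h2 with h3 | h3
    · exact Or.inl (Subtype.ext h3)
    · have ha : a = 1 := by linarith
      have hb : b = 0 := by
        have : b ^ 2 = 0 := by rw [ha] at e1; linarith
        exact pow_eq_zero_iff two_ne_zero |>.1 this
      have h4 : Disk.turn t = Disk.turn (0 : I) :=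
        Subtype.ext (Complex.ext (by simpa using ha) (by simpa using hb))
      rcases Disk.turn_unit_eq_turn_unit h4 with h5 | h5
      · exact Or.inr (Or.inl h5)
      · exact Or.inr h5.1
  have hr : r = r' := Subtype.ext (mul_right_cancel₀ hne h1)
  subst hr
  refine ⟨rfl, ?_⟩
  have hr0 : (r : ℝ) ≠ 0 := left_ne_zero_of_mul hne
  have h4 : Disk.turn t = Disk.turn t' := by
    refine Subtype.ext (Complex.ext ?_ ?_)
    · exact mul_left_cancel₀ hr0 (by linarith)
    · exact mul_left_cancel₀ hr0 (by linarith)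
  rcases Disk.turn_unit_eq_turn_unit h4 with h5 | h5
  · exact h5
  · exact absurd (Disk.horo_eq_turn_zero (Or.inr h5.1)) h0

theorem Disk.exists_horo (z : Disk) : ∃ r t : I, z = Disk.horo r t := by
  by_cases h1 : (z : ℂ).re = 1
  · refine ⟨0, 0, Subtype.ext ?_⟩
    have hz : (z : ℂ).re ^ 2 + (z : ℂ).im ^ 2 ≤ 1 := by
      have := z.norm_le_one
      rw [← sq_le_one_iff₀ (norm_nonneg _), ← Complex.normSq_eq_norm_sq,
        Complex.normSq_apply] at this
      linarith
    have him : (z : ℂ).im = 0 := by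
      rw [h1] at hz
      have : (z : ℂ).im ^ 2 ≤ 0 := by linarith
      exact pow_eq_zero_iff two_ne_zero |>.1 (le_antisymm this (sq_nonneg _))
    rw [Disk.coe_horo]
    exact Complex.ext (by simp [h1]) (by simp [him])
  have hz : (z : ℂ).re ^ 2 + (z : ℂ).im ^ 2 ≤ 1 := by
    have := z.norm_le_one
    rw [← sq_le_one_iff₀ (norm_nonneg _), ← Complex.normSq_eq_norm_sq,
      Complex.normSq_apply] at this
    linarith
  set x := (z : ℂ).re with hx
  set y := (z : ℂ).im with hy
  have hx1 : x < 1 := lt_of_le_of_ne (by nlinarith [sq_nonneg y]) h1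
  have hp : 0 < 2 * (1 - x) := by linarith
  -- The radius of the circle through `z` that is tangent to the unit circle at `1`, solved from `|z
  -- - 1|² = 2r(1 - Re z)`.
  set r : ℝ := ((1 - x) ^ 2 + y ^ 2) / (2 * (1 - x)) with hr
  have hr0 : 0 < r := by
    have : 0 < 1 - x := by linarith
    positivity
  have hr1 : r ≤ 1 := by
    rw [hr, div_le_one hp]
    nlinarith
  have hreq : r * (2 * (1 - x)) = (1 - x) ^ 2 + y ^ 2 := div_mul_cancel₀ _ hp.ne'
  set w : ℂ := 1 + ((z : ℂ) - 1) / r with hw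
  have hwre : w.re = 1 + (x - 1) / r := by simp [hw, hx]
  have hwim : w.im = y / r := by simp [hw, hy]
  have hwn : ‖w‖ = 1 := by
    rw [← sq_eq_sq₀ (norm_nonneg _) zero_le_one, ← Complex.normSq_eq_norm_sq,
      Complex.normSq_apply, hwre, hwim]
    field_simp
    linear_combination -hreq
  obtain ⟨t, ht⟩ := Disk.exists_turn_unit (z := ⟨w, mem_closedBall_zero_iff.2 hwn.le⟩) hwn
  refine ⟨⟨r, hr0.le, hr1⟩, t, Subtype.ext ?_⟩
  rw [Disk.coe_horo, ← Subtype.ext_iff.1 ht]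
  have : (r : ℂ) ≠ 0 := by exact_mod_cast hr0.ne'
  simp only [hw]
  field_simp
  ring

theorem Disk.isQuotientMap_horo : IsQuotientMap fun x : I × I => Disk.horo x.1 x.2 := by
  refine IsClosedMap.isQuotientMap Disk.continuous_horo.isClosedMap
    Disk.continuous_horo fun z => ?_
  obtain ⟨r, t, rfl⟩ := z.exists_horo
  exact ⟨(r, t), rfl⟩

theorem exists_lift_of_isQuotientMap {X Y Z : Type*} [TopologicalSpace X] [TopologicalSpace Y]
    [TopologicalSpace Z] {p : X → Y} (hp : IsQuotientMap p) {g : X → Z} (hg : Continuous g)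
    (h : ∀ a b, p a = p b → g a = g b) : ∃ G : Y → Z, Continuous G ∧ ∀ x, G (p x) = g x := by
  choose c hc using hp.surjective
  have hG : ∀ x, g (c (p x)) = g x := fun x => h _ _ (hc (p x))
  exact ⟨fun y => g (c y), hp.continuous_iff.2 (by simpa [Function.comp_def, hG] using hg), hG⟩

/-! ### Attaching petals to the disk -/

/-- A monotone map of degree one of the circle (written on the universal cover) that is constant
on the disjoint arcs from `a j` to `b j` and injective otherwise. -/
structure IsCollapse {J : Type*} (c : ℝ → ℝ) (a b : J → ℝ) : Prop where
  continuous : Continuous c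
  monotone : Monotone c
  add_one : ∀ s, c (s + 1) = c s + 1
  lt : ∀ j, a j < b j
  const : ∀ j, c (a j) = c (b j)
  eq_imp : ∀ s s', c s = c s' → s = s' ∨ ∃ (j : J) (m : ℤ),
    s ∈ Icc (a j + m) (b j + m) ∧ s' ∈ Icc (a j + m) (b j + m)
  disjoint : ∀ (s : ℝ) (j k : J) (l m : ℤ), s ∈ Icc (a j + l) (b j + l) →
    s ∈ Icc (a k + m) (b k + m) → j = k ∧ l = m

/-- The union of the open arcs, on the universal cover. -/
def openArcs {J : Type*} (a b : J → ℝ) : Set ℝ :=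
  {s | ∃ (j : J) (m : ℤ), a j + m < s ∧ s < b j + m}

theorem isOpen_openArcs {J : Type*} (a b : J → ℝ) : IsOpen (openArcs a b) := by
  have : openArcs a b = ⋃ (j : J) (m : ℤ), Ioo (a j + m) (b j + m) := by
    ext s; simp [openArcs]
  rw [this]
  exact isOpen_iUnion fun j => isOpen_iUnion fun m => isOpen_Ioo

theorem add_int_mem_openArcs {J : Type*} {a b : J → ℝ} {s : ℝ} (m : ℤ)
    (hs : s ∈ openArcs a b) : s + m ∈ openArcs a b := by
  obtain ⟨j, l, h1, h2⟩ := hs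
  exact ⟨j, l + m, by push_cast; linarith, by push_cast; linarith⟩

theorem add_int_mem_openArcs_iff {J : Type*} {a b : J → ℝ} {s : ℝ} (m : ℤ) :
    s + m ∈ openArcs a b ↔ s ∈ openArcs a b :=
  ⟨fun h => by simpa using add_int_mem_openArcs (-m) h, add_int_mem_openArcs m⟩

/-- A radius that is equal to `1` exactly outside of the open arcs. -/
noncomputable def arcRadius {J : Type*} (a b : J → ℝ) (s : ℝ) : I :=
  ⟨1 / (1 + Metric.infDist s (openArcs a b)ᶜ), by
    have := Metric.infDist_nonneg (x := s) (s := (openArcs a b)ᶜ)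
    exact ⟨by positivity, by rw [div_le_one (by positivity)]; linarith⟩⟩

theorem coe_arcRadius {J : Type*} (a b : J → ℝ) (s : ℝ) :
    (arcRadius a b s : ℝ) = 1 / (1 + Metric.infDist s (openArcs a b)ᶜ) := rfl

theorem arcRadius_pos {J : Type*} (a b : J → ℝ) (s : ℝ) : 0 < (arcRadius a b s : ℝ) := by
  have := Metric.infDist_nonneg (x := s) (s := (openArcs a b)ᶜ)
  rw [coe_arcRadius]
  positivity

theorem continuous_arcRadius {J : Type*} (a b : J → ℝ) : Continuous (arcRadius a b) := by
  refine Continuous.subtype_mk (Continuous.div continuous_const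
    (continuous_const.add (Metric.continuous_infDist_pt _)) fun s => ?_) _
  have := Metric.infDist_nonneg (x := s) (s := (openArcs a b)ᶜ)
  exact (add_pos_of_pos_of_nonneg one_pos this).ne'

theorem arcRadius_add_int {J : Type*} (a b : J → ℝ) (s : ℝ) (m : ℤ) :
    arcRadius a b (s + m) = arcRadius a b s := by
  have h : (fun x : ℝ => x + m) '' (openArcs a b)ᶜ = (openArcs a b)ᶜ := by
    ext x
    constructor
    · rintro ⟨y, hy, rfl⟩
      exact fun h => hy ((add_int_mem_openArcs_iff m).1 h)
    · intro hx
      refine ⟨x + (-m : ℤ), fun h => hx ((add_int_mem_openArcs_iff (-m)).1 h), ?_⟩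
      push_cast; ring
  have h2 := Metric.infDist_image (x := s) (t := (openArcs a b)ᶜ)
    (isometry_add_right (m : ℝ))
  rw [h] at h2
  exact Subtype.ext (by rw [coe_arcRadius, coe_arcRadius, h2])

/-! ### Fibres of the collapsing map of the disk -/

namespace IsCollapse

variable {J : Type*} {c : ℝ → ℝ} {a b : J → ℝ}

theorem add_int (hc : IsCollapse c a b) (s : ℝ) (m : ℤ) : c (s + m) = c s + m := by
  let f : CircleDeg1Lift := ⟨⟨c, hc.monotone⟩, hc.add_one⟩
  exact f.map_add_int s m

theorem left_notMem (hc : IsCollapse c a b) (j : J) (m : ℤ) : a j + m ∉ openArcs a b := by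
  rintro ⟨k, l, h1, h2⟩
  have := hc.lt j
  obtain ⟨rfl, rfl⟩ := hc.disjoint (a j + m) j k m l ⟨le_rfl, by linarith⟩ ⟨h1.le, h2.le⟩
  exact lt_irrefl _ h1

theorem right_notMem (hc : IsCollapse c a b) (j : J) (m : ℤ) : b j + m ∉ openArcs a b := by
  rintro ⟨k, l, h1, h2⟩
  have := hc.lt j
  obtain ⟨rfl, rfl⟩ := hc.disjoint (b j + m) j k m l ⟨by linarith, le_rfl⟩ ⟨h1.le, h2.le⟩
  exact lt_irrefl _ h2

theorem arcRadius_eq_one (hc : IsCollapse c a b) {s : ℝ} : arcRadius a b s = 1 ↔ s ∉ openArcs a b := by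
  -- `Metric.infDist` to the empty set is `0`, so the criterion for closed sets needs a point
  -- outside the arcs.
  have hne : ((openArcs a b)ᶜ).Nonempty := by
    by_cases hJ : Nonempty J
    · exact ⟨_, hc.left_notMem hJ.some 0⟩
    · exact ⟨0, fun ⟨j, _⟩ => hJ ⟨j⟩⟩
  have h0 := Metric.infDist_nonneg (x := s) (s := (openArcs a b)ᶜ)
  have h1 : arcRadius a b s = 1 ↔ Metric.infDist s (openArcs a b)ᶜ = 0 := by
    rw [Subtype.ext_iff, coe_arcRadius, Set.Icc.coe_one, div_eq_one_iff_eq (by positivity)]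
    constructor <;> intro h <;> linarith
  rw [h1, ← (isOpen_openArcs a b).isClosed_compl.mem_iff_infDist_zero hne, mem_compl_iff]

theorem const_on (hc : IsCollapse c a b) {j : J} {m : ℤ} {s : ℝ} (hs : s ∈ Icc (a j + m) (b j + m)) :
    c s = c (a j) + m := by
  have h1 := hc.monotone hs.1
  have h2 := hc.monotone hs.2
  rw [hc.add_int] at h1 h2
  rw [← hc.const j] at h2
  exact le_antisymm h2 h1

theorem eq_endpoint {j : J} {m : ℤ} {s : ℝ} (hs : s ∈ Icc (a j + m) (b j + m))
    (h : s ∉ openArcs a b) : s = a j + m ∨ s = b j + m := by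
  by_contra! hne
  exact h ⟨j, m, lt_of_le_of_ne hs.1 hne.1.symm, lt_of_le_of_ne hs.2 hne.2⟩

/-- Intermediate value theorem: the angle function is continuous and commutes with integer
translations, hence unbounded in both directions. -/
theorem exists_slide_eq (hc : IsCollapse c a b) (R : I) (S : ℝ) : ∃ s, (1 - (R : ℝ)) * s + R * c s = S := by
  have hcont := hc.continuous
  have hcont' : Continuous fun s => (1 - (R : ℝ)) * s + R * c s := by fun_prop
  set k : ℤ := ⌈|S - c 0| + |S|⌉
  have hk : |S - c 0| + |S| ≤ k := Int.le_ceil _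
  have hkk : ∀ m : ℤ, (1 - (R : ℝ)) * m + R * c m = m + R * c 0 := by
    intro m
    have := hc.add_int 0 m
    rw [zero_add] at this
    rw [this]; ring
  have hR0 := R.2.1
  have hR1 := R.2.2
  have h1 := abs_le.1 (le_refl |S - c 0|)
  have h2 := abs_le.1 (le_refl |S|)
  have h3 := abs_nonneg (S - c 0)
  have h4 := abs_nonneg S
  have hconv : S - R * c 0 = (1 - (R : ℝ)) * S + R * (S - c 0) := by ring
  have hlo : ((-k : ℤ) : ℝ) + R * c 0 ≤ S := by
    push_cast
    nlinarith
  have hhi : S ≤ (k : ℝ) + R * c 0 := by nlinarith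
  exact mem_range_of_exists_le_of_exists_ge hcont' ⟨((-k : ℤ) : ℝ), by rw [hkk]; exact hlo⟩
    ⟨(k : ℝ), by rw [hkk]; exact hhi⟩

/-- The map of the disk that collapses the arcs of its boundary. -/
noncomputable def slide (c : ℝ → ℝ) (R : I) (s : ℝ) : Disk :=
  Disk.polar R ((1 - (R : ℝ)) * s + R * c s)

theorem norm_slide (R : I) (s : ℝ) : ‖(slide c R s : ℂ)‖ = R := Disk.norm_polar _ _

theorem slide_zero (s s' : ℝ) : slide c 0 s = slide c 0 s' :=
  Disk.polar_eq_polar.2 ⟨rfl, Or.inl rfl⟩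

theorem slide_one (s : ℝ) : slide c 1 s = Disk.turn (c s) := by
  simp [slide]

theorem continuous_slide (hc : IsCollapse c a b) : Continuous fun x : I × ℝ => slide c x.1 x.2 := by
  have := hc.continuous
  exact Disk.continuous_polar.comp
    (f := fun x : I × ℝ => (x.1, (1 - (x.1 : ℝ)) * x.2 + x.1 * c x.2)) (by fun_prop)

theorem slide_add_int (hc : IsCollapse c a b) (R : I) (s : ℝ) (m : ℤ) : slide c R (s + m) = slide c R s := by
  refine Disk.polar_eq_polar.2 ⟨rfl, Or.inr ⟨m, ?_⟩⟩
  rw [hc.add_int]; ring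

/-- On the circle of radius `R < 1` the angle `(1 - R) s + R c(s)` is strictly increasing in `s`, so
nothing is collapsed there. Only on the unit circle are the fibres those of `c`. -/
theorem eq_of_slide_eq (hc : IsCollapse c a b) {R R' : I} {s s' : ℝ} (h : slide c R s = slide c R' s') :
    R = R' ∧ (R = 0 ∨ (∃ m : ℤ, s = s' + m) ∨
      R = 1 ∧ ∃ (j : J) (l m : ℤ), s ∈ Icc (a j + l) (b j + l) ∧
        s' + m ∈ Icc (a j + l) (b j + l)) := by
  obtain ⟨rfl, h0 | ⟨m, hm⟩⟩ := Disk.polar_eq_polar.1 h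
  · exact ⟨rfl, Or.inl h0⟩
  refine ⟨rfl, Or.inr ?_⟩
  have hm' : (1 - (R : ℝ)) * s + R * c s = (1 - (R : ℝ)) * (s' + m) + R * c (s' + m) := by
    rw [hm, hc.add_int]; ring
  by_cases h1 : R = 1
  · subst h1
    rcases hc.eq_imp s (s' + m) (by simpa using hm') with h2 | ⟨j, l, h2, h3⟩
    · exact Or.inl ⟨m, h2⟩
    · exact Or.inr ⟨rfl, j, l, m, h2, h3⟩
  · left
    refine ⟨m, ?_⟩
    have hlt : 0 < 1 - (R : ℝ) := by
      have : (R : ℝ) ≠ 1 := fun h => h1 (Subtype.ext h)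
      have := lt_of_le_of_ne R.2.2 this
      linarith
    have hmono : StrictMono fun s => (1 - (R : ℝ)) * s + R * c s := by
      intro x y hxy
      have h3 := mul_lt_mul_of_pos_left hxy hlt
      have h4 := mul_le_mul_of_nonneg_left (hc.monotone hxy.le) R.2.1
      change _ + _ < _ + _
      linarith
    exact hmono.injective hm'

end IsCollapse

/-- The disk as the union of a disk `n` and petals `p j`: the arc of the boundary of `n` from
`a j` to `b j` is closed up and glued to the boundary of the petal. -/
structure IsPetalDecomposition {J : Type*} (c : ℝ → ℝ) (a b : J → ℝ) (n : Disk → Disk)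
    (p : J → Disk → Disk) : Prop where
  continuous_core : Continuous n
  continuous_petal : ∀ j, Continuous (p j)
  core_turn : ∀ s, s ∉ openArcs a b → n (Disk.turn s) = Disk.turn (c s)
  core_arc : ∀ (j : J) (t : I), n (Disk.turn (a j + (b j - a j) * t)) = p j (Disk.turn t)
  surjective : ∀ z, (∃ x, n x = z) ∨ ∃ j x, p j x = z
  core_eq_core : ∀ x x', n x = n x' → x = x' ∨ ∃ j,
    (x = Disk.turn (a j) ∨ x = Disk.turn (b j)) ∧ (x' = Disk.turn (a j) ∨ x' = Disk.turn (b j))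
  petal_eq_petal : ∀ j j' y y', p j y = p j' y' → j = j' ∧ y = y'
  core_eq_petal : ∀ x j y, n x = p j y →
    ∃ t : I, x = Disk.turn (a j + (b j - a j) * t) ∧ y = Disk.turn t
  petal_boundary : ∀ j y, ‖(p j y : ℂ)‖ = 1 → y = Disk.turn 0

/-- `slide` interpolates between the identity at the centre and `c` on the unit circle. The curve of
radius `ρ(s)`, which leaves the unit circle exactly over the open arcs, cuts the source disk into
the region below it, whose image is the core, and one lens over each arc. `slide` crushes the outer
side of a lens to a point, so the image of a lens is a disk foliated by loops through one point,
which is how horocycles foliate a petal. -/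
theorem IsCollapse.exists_isPetalDecomposition {J : Type*} {c : ℝ → ℝ} {a b : J → ℝ}
    (hc : IsCollapse c a b) : ∃ n p, IsPetalDecomposition c a b n p := by
  set ρ := arcRadius a b with hρ
  have hρc : Continuous ρ := continuous_arcRadius a b
  have hρpos : ∀ s, 0 < (ρ s : ℝ) := arcRadius_pos a b
  have hρone : ∀ s, ρ s = 1 ↔ s ∉ openArcs a b := fun s => hc.arcRadius_eq_one
  have hρle : ∀ s, (ρ s : ℝ) ≤ 1 := fun s => (ρ s).2.2
  have hslide := hc.continuous_slide
  obtain ⟨n, hn, hn'⟩ := exists_lift_of_isQuotientMap Disk.isQuotientMap_polar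
    (g := fun x : I × ℝ => IsCollapse.slide c (x.1 * ρ x.2) x.2)
    (hslide.comp (f := fun x : I × ℝ => (x.1 * ρ x.2, x.2)) (by fun_prop)) (by
      rintro ⟨r, s⟩ ⟨r', s'⟩ h
      dsimp only at h ⊢
      obtain ⟨rfl, rfl | ⟨m, rfl⟩⟩ := Disk.polar_eq_polar.1 h
      · simpa using IsCollapse.slide_zero s s'
      · simp only [hρ, arcRadius_add_int, hc.slide_add_int])
  let σ' : J → I → ℝ := fun j t => a j + (b j - a j) * t
  have hσmem : ∀ j t, σ' j t ∈ Icc (a j) (b j) := by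
    intro j t
    have h1 := hc.lt j
    have h2 := t.2.1
    have h3 := t.2.2
    constructor
    · change a j ≤ a j + (b j - a j) * t
      nlinarith
    · change a j + (b j - a j) * t ≤ b j
      nlinarith
  have hσmem' : ∀ j t, σ' j t ∈ Icc (a j + (0 : ℤ)) (b j + (0 : ℤ)) := by
    intro j t; simpa using hσmem j t
  -- Radial coordinate in a lens: `r = 1` is the curve `ρ` shared with the core, `r = 0` the unit
  -- circle.
  let depth : I → ℝ → I := fun r s => unitInterval.symm (r * unitInterval.symm (ρ s))
  have hdepth : ∀ r s, (depth r s : ℝ) = 1 - r * (1 - ρ s) := fun r s => rfl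
  have hdepth_pos : ∀ r s, 0 < (depth r s : ℝ) := by
    intro r s
    rw [hdepth]
    have := hρpos s
    have := hρle s
    have h2 := r.2.1
    have h3 := r.2.2
    nlinarith
  have hend : ∀ j t, ρ (σ' j t) = 1 → t = 0 ∨ t = 1 := by
    intro j t h
    have h1 := hc.lt j
    rcases IsCollapse.eq_endpoint (hσmem' j t) ((hρone _).1 h) with h2 | h2
    · left
      have h3 : (b j - a j) * (t : ℝ) = 0 := by
        have : a j + (b j - a j) * (t : ℝ) = a j + ((0 : ℤ) : ℝ) := h2
        push_cast at this; linarith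
      rcases mul_eq_zero.1 h3 with h4 | h4
      · linarith
      · exact Subtype.ext h4
    · right
      have h3 : (b j - a j) * ((t : ℝ) - 1) = 0 := by
        have : a j + (b j - a j) * (t : ℝ) = b j + ((0 : ℤ) : ℝ) := h2
        push_cast at this; linarith
      rcases mul_eq_zero.1 h3 with h4 | h4
      · linarith
      · exact Subtype.ext (by simpa [sub_eq_zero] using h4)
  have hend' : ∀ j (t : I), (t = 0 ∨ t = 1) → ρ (σ' j t) = 1 := by
    intro j t h
    rw [hρone]
    rcases h with rfl | rfl
    · have := hc.left_notMem j 0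
      simpa [σ'] using this
    · have := hc.right_notMem j 0
      simpa [σ'] using this
  have hdeg : ∀ j r t, (r = 0 ∨ t = 0 ∨ t = 1) → depth r (σ' j t) = 1 := by
    intro j r t h
    refine Subtype.ext ?_
    rw [hdepth]
    rcases h with rfl | h
    · simp
    · rw [hend' j t h]; simp
  have hdeg' : ∀ j r t, depth r (σ' j t) = 1 → (r = 0 ∨ t = 0 ∨ t = 1) := by
    intro j r t h
    have h1 : (depth r (σ' j t) : ℝ) = 1 := by rw [h]; rfl
    rw [hdepth] at h1
    rcases mul_eq_zero.1 (show (r : ℝ) * (1 - ρ (σ' j t)) = 0 by linarith) with h2 | h2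
    · exact Or.inl (Subtype.ext h2)
    · exact Or.inr (hend j t (Subtype.ext (by simpa using (sub_eq_zero.1 h2).symm)))
  have hp : ∀ j, ∃ p : Disk → Disk, Continuous p ∧
      ∀ r t, p (Disk.horo r t) = IsCollapse.slide c (depth r (σ' j t)) (σ' j t) := by
    intro j
    obtain ⟨p, hp, hp'⟩ := exists_lift_of_isQuotientMap Disk.isQuotientMap_horo
      (g := fun x : I × I => IsCollapse.slide c (depth x.1 (σ' j x.2)) (σ' j x.2))
      (hslide.comp (f := fun x : I × I => (depth x.1 (σ' j x.2), σ' j x.2))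
        (by fun_prop)) (by
        rintro ⟨r, t⟩ ⟨r', t'⟩ h
        rcases Disk.horo_eq_horo h with ⟨rfl, rfl⟩ | ⟨h1, h2⟩
        · rfl
        · simp only [hdeg j r t h1, hdeg j r' t' h2, IsCollapse.slide_one,
            hc.const_on (hσmem' j t), hc.const_on (hσmem' j t')])
    exact ⟨p, hp, fun r t => hp' (r, t)⟩
  choose p hp hp' using hp
  replace hn' : ∀ r s, n (Disk.polar r s) = IsCollapse.slide c (r * ρ s) s :=
    fun r s => hn' (r, s)
  have hturn : ∀ s, n (Disk.turn s) = IsCollapse.slide c (ρ s) s := by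
    intro s
    have := hn' 1 s
    rwa [Disk.polar_one, one_mul] at this
  have hρint : ∀ s (m : ℤ), ρ (s + m) = ρ s := arcRadius_add_int a b
  refine ⟨n, p, hn, hp, ?_, ?_, ?_, ?_, ?_, ?_, ?_⟩
  · intro s hs
    rw [hturn, (hρone s).2 hs, IsCollapse.slide_one]
  · intro j t
    rw [hturn, ← Disk.horo_one, hp']
    congr 1
    exact Subtype.ext (by rw [hdepth]; simp [σ'])
  · intro z
    obtain ⟨R, S, rfl⟩ := z.exists_polar
    obtain ⟨s, hs⟩ := hc.exists_slide_eq R S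
    -- After undoing the change of angle, the point lies below or above the curve `ρ`.
    by_cases hR : (R : ℝ) ≤ ρ s
    · left
      refine ⟨Disk.polar ⟨R / ρ s, div_nonneg R.2.1 (hρpos s).le,
        (div_le_one (hρpos s)).2 hR⟩ s, ?_⟩
      rw [hn', ← hs]
      have : (⟨R / ρ s, div_nonneg R.2.1 (hρpos s).le,
        (div_le_one (hρpos s)).2 hR⟩ : I) * ρ s = R :=
        Subtype.ext (div_mul_cancel₀ _ (hρpos s).ne')
      rw [this]
      rfl
    · right
      push Not at hR
      have hlt : (ρ s : ℝ) < 1 := hR.trans_le R.2.2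
      have hU : s ∈ openArcs a b := by
        by_contra h
        rw [(hρone s).2 h] at hlt
        simp at hlt
      obtain ⟨j, m, h1, h2⟩ := hU
      have h3 := hc.lt j
      have h4 : 0 < b j - a j := by linarith
      have h5 : 0 < 1 - (ρ s : ℝ) := by linarith
      let t : I := ⟨(s - m - a j) / (b j - a j), div_nonneg (by linarith) h4.le,
        (div_le_one h4).2 (by linarith)⟩
      let r : I := ⟨(1 - R) / (1 - ρ s), div_nonneg (by linarith [R.2.2]) h5.le,
        (div_le_one h5).2 (by linarith)⟩
      have ht : σ' j t + m = s := by
        change a j + (b j - a j) * ((s - m - a j) / (b j - a j)) + m = s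
        rw [mul_div_cancel₀ _ h4.ne']; ring
      refine ⟨j, Disk.horo r t, ?_⟩
      rw [hp', ← hs]
      have hd : depth r (σ' j t) = R := by
        refine Subtype.ext ?_
        rw [hdepth, ← hρint _ m, ht]
        change 1 - (1 - (R : ℝ)) / (1 - ρ s) * (1 - ρ s) = R
        rw [div_mul_cancel₀ _ h5.ne']; ring
      rw [hd, ← hc.slide_add_int _ _ m, ht]
      rfl
  · intro x x' h
    obtain ⟨r, s, rfl⟩ := x.exists_polar
    obtain ⟨r', s', rfl⟩ := x'.exists_polar
    rw [hn', hn'] at h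
    obtain ⟨h1, h2⟩ := hc.eq_of_slide_eq h
    have h1' : (r : ℝ) * ρ s = r' * ρ s' := congrArg Subtype.val h1
    rcases h2 with h2 | ⟨m, hm⟩ | ⟨h2, j, l, m, h3, h4⟩
    · left
      have h2' : (r : ℝ) * ρ s = 0 := congrArg Subtype.val h2
      have hr : r = 0 := Subtype.ext ((mul_eq_zero.1 h2').resolve_right (hρpos s).ne')
      have hr' : r' = 0 :=
        Subtype.ext ((mul_eq_zero.1 (h1' ▸ h2')).resolve_right (hρpos s').ne')
      exact Disk.polar_eq_polar.2 ⟨hr.trans hr'.symm, Or.inl hr⟩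
    · left
      rw [hm, hρint] at h1'
      exact Disk.polar_eq_polar.2 ⟨Subtype.ext (mul_right_cancel₀ (hρpos s').ne' h1'),
        Or.inr ⟨m, hm⟩⟩
    · right
      have key : ∀ (r : I) (s : ℝ), r * ρ s = 1 → r = 1 ∧ ρ s = 1 := by
        intro r s h
        have h' : (r : ℝ) * ρ s = 1 := congrArg Subtype.val h
        have e1 := r.2.1
        have e2 := r.2.2
        have e3 := hρpos s
        have e4 := hρle s
        exact ⟨Subtype.ext (by change (r : ℝ) = 1; nlinarith),
          Subtype.ext (by change (ρ s : ℝ) = 1; nlinarith)⟩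
      obtain ⟨rfl, e1⟩ := key r s h2
      obtain ⟨rfl, e2⟩ := key r' s' (h1 ▸ h2)
      refine ⟨j, ?_, ?_⟩
      · rw [Disk.polar_one]
        rcases IsCollapse.eq_endpoint h3 ((hρone _).1 e1) with e | e
        · left; rw [e, Disk.turn_add_int]
        · right; rw [e, Disk.turn_add_int]
      · rw [Disk.polar_one]
        rcases IsCollapse.eq_endpoint h4 ((hρone _).1 (by rw [hρint, e2])) with e | e
        · left; rw [← Disk.turn_add_int _ m, e, Disk.turn_add_int]
        · right; rw [← Disk.turn_add_int _ m, e, Disk.turn_add_int]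
  · intro j j' y y' h
    obtain ⟨r, t, rfl⟩ := y.exists_horo
    obtain ⟨r', t', rfl⟩ := y'.exists_horo
    rw [hp', hp'] at h
    obtain ⟨h1, h2⟩ := hc.eq_of_slide_eq h
    have h1' : (depth r (σ' j t) : ℝ) = depth r' (σ' j' t') := congrArg Subtype.val h1
    rw [hdepth, hdepth] at h1'
    rcases h2 with h2 | ⟨m, hm⟩ | ⟨h2, k, l, m, h3, h4⟩
    · exact absurd (congrArg Subtype.val h2) (hdepth_pos _ _).ne'
    · have e1 : σ' j t ∈ Icc (a j' + m) (b j' + m) := by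
        have := hσmem j' t'
        rw [hm]
        exact ⟨by linarith [this.1], by linarith [this.2]⟩
      obtain ⟨rfl, rfl⟩ := hc.disjoint _ _ _ _ _ (hσmem' j t) e1
      refine ⟨rfl, ?_⟩
      have e2 : σ' j t = σ' j t' := by simpa using hm
      have e3 : t = t' := by
        have e4 : (b j - a j) * (t : ℝ) = (b j - a j) * t' := add_left_cancel e2
        exact Subtype.ext (mul_left_cancel₀ (by linarith [hc.lt j]) e4)
      subst e3
      by_cases e5 : ρ (σ' j t) = 1
      · have e6 := Or.inr (a := r = 0) (hend j t e5)
        have e7 := Or.inr (a := r' = 0) (hend j t e5)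
        rw [Disk.horo_eq_turn_zero e6, Disk.horo_eq_turn_zero e7]
      · have e6 : (1 - (ρ (σ' j t) : ℝ)) ≠ 0 := fun h => e5 (Subtype.ext (by
          simpa using (sub_eq_zero.1 h).symm))
        have e7 : r = r' := Subtype.ext (mul_right_cancel₀ e6 (by linarith))
        rw [e7]
    · have e1 := hc.disjoint _ _ _ _ _ (hσmem' j t) h3
      have e2 : σ' j' t' + m ∈ Icc (a j' + m) (b j' + m) := by
        have := hσmem j' t'
        exact ⟨by linarith [this.1], by linarith [this.2]⟩
      have e3 := hc.disjoint _ _ _ _ _ e2 h4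
      refine ⟨e1.1.trans e3.1.symm, ?_⟩
      rw [Disk.horo_eq_turn_zero (hdeg' _ _ _ h2), Disk.horo_eq_turn_zero (hdeg' _ _ _ (h1 ▸ h2))]
  · intro x j y h
    obtain ⟨r, s, rfl⟩ := x.exists_polar
    obtain ⟨r', t, rfl⟩ := y.exists_horo
    rw [hn', hp'] at h
    obtain ⟨h1, h2⟩ := hc.eq_of_slide_eq h
    have h1' : (r : ℝ) * ρ s = depth r' (σ' j t) := congrArg Subtype.val h1
    rw [hdepth] at h1'
    rcases h2 with h2 | ⟨m, hm⟩ | ⟨h2, k, l, m, h3, h4⟩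
    · exact absurd (congrArg Subtype.val (h1 ▸ h2)) (hdepth_pos _ _).ne'
    · rw [hm, hρint] at h1'
      -- The radius is at most `ρ` in the core and at least `ρ` in the petal. Written as a vanishing
      -- sum of two nonnegative terms, equality forces both points onto the common curve.
      have e1 : (1 - (r' : ℝ)) * (1 - ρ (σ' j t)) + ρ (σ' j t) * (1 - r) = 0 := by
        linear_combination -h1'
      have e2 : 0 ≤ (1 - (r' : ℝ)) * (1 - ρ (σ' j t)) :=
        mul_nonneg (by linarith [r'.2.2]) (by linarith [hρle (σ' j t)])
      have e3 : 0 ≤ (ρ (σ' j t) : ℝ) * (1 - r) :=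
        mul_nonneg (hρpos _).le (by linarith [r.2.2])
      have e4 : (ρ (σ' j t) : ℝ) * (1 - r) = 0 := by linarith
      have e5 : (1 - (r' : ℝ)) * (1 - ρ (σ' j t)) = 0 := by linarith
      have e6 : r = 1 := Subtype.ext (by
        have := (mul_eq_zero.1 e4).resolve_left (hρpos _).ne'
        change (r : ℝ) = 1
        linarith)
      refine ⟨t, ?_, ?_⟩
      · rw [e6, Disk.polar_one, hm, Disk.turn_add_int]
      · rcases mul_eq_zero.1 e5 with e7 | e7
        · have : r' = 1 := Subtype.ext (by change (r' : ℝ) = 1; linarith)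
          rw [this, Disk.horo_one]
        · have e8 : ρ (σ' j t) = 1 := Subtype.ext (by
            change (ρ (σ' j t) : ℝ) = 1; linarith)
          rw [Disk.horo_eq_turn_zero (Or.inr (hend j t e8))]
          rcases hend j t e8 with rfl | rfl <;> simp
    · have e1 := hdeg' _ _ _ (h1 ▸ h2)
      have e2 : σ' j t + m ∈ Icc (a j + m) (b j + m) := by
        have := hσmem j t
        exact ⟨by linarith [this.1], by linarith [this.2]⟩
      obtain ⟨rfl, rfl⟩ := hc.disjoint _ _ _ _ _ e2 h4
      have e3 : (r : ℝ) * ρ s = 1 := congrArg Subtype.val h2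
      have e4 : r = 1 := Subtype.ext (by
        change (r : ℝ) = 1
        nlinarith [r.2.1, r.2.2, hρpos s, hρle s])
      have e5 : ρ s = 1 := Subtype.ext (by
        change (ρ s : ℝ) = 1
        nlinarith [r.2.1, r.2.2, hρpos s, hρle s])
      rw [e4, Disk.polar_one, Disk.horo_eq_turn_zero e1]
      rcases IsCollapse.eq_endpoint h3 ((hρone _).1 e5) with e | e
      · exact ⟨0, by simp [e, Disk.turn_add_int], by simp⟩
      · exact ⟨1, by simp [e, Disk.turn_add_int], by simp⟩
  · intro j y h
    obtain ⟨r, t, rfl⟩ := y.exists_horo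
    rw [hp', IsCollapse.norm_slide] at h
    exact Disk.horo_eq_turn_zero (hdeg' j r t (Subtype.ext h))

/-! ### The projective plane as a quotient of the disk -/

/-- A quotient map from the disk that glues exactly the opposite boundary points. -/
structure IsAntipodalQuotient {P : Type*} [TopologicalSpace P] (q : Disk → P) : Prop where
  isQuotientMap : IsQuotientMap q
  eq_iff : ∀ z w : Disk, q z = q w ↔ z = w ∨ ‖(z : ℂ)‖ = 1 ∧ (w : ℂ) = -(z : ℂ)

theorem Disk.dense_interior : Dense {z : Disk | ‖(z : ℂ)‖ < 1} := by
  rw [Subtype.dense_iff]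
  have : ((↑) : Disk → ℂ) '' {z : Disk | ‖(z : ℂ)‖ < 1} = Metric.ball 0 1 := by
    ext x
    simp only [mem_image, mem_ofPred_eq, mem_ball_zero_iff]
    constructor
    · rintro ⟨z, hz, rfl⟩; exact hz
    · intro hx; exact ⟨⟨x, mem_closedBall_zero_iff.2 hx.le⟩, hx, rfl⟩
  rw [this, closure_ball _ one_ne_zero]

theorem Disk.isPreconnected_of_convex {s : Set Disk} {t : Set ℂ} (ht : Convex ℝ t)
    (h : ∀ x : ℂ, x ∈ t ↔ ∃ hx : x ∈ Metric.closedBall (0 : ℂ) 1, (⟨x, hx⟩ : Disk) ∈ s) :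
    IsPreconnected s := by
  rw [← IsInducing.subtypeVal.isPreconnected_image]
  have : ((↑) : Disk → ℂ) '' s = t := by
    ext x
    rw [h]
    constructor
    · rintro ⟨z, hz, rfl⟩; exact ⟨z.2, hz⟩
    · rintro ⟨hx, h⟩; exact ⟨_, h, rfl⟩
  rw [this]
  exact ht.isPreconnected

theorem Disk.turn_add_quarter_ne (s : ℝ) : Disk.turn (s + 1 / 4) ≠ Disk.turn s := by
  intro h
  obtain ⟨m, hm⟩ := Disk.turn_eq_turn.1 h
  have : ((4 * m : ℤ) : ℝ) = ((1 : ℤ) : ℝ) := by push_cast; linarith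
  have := Int.cast_injective this
  omega

namespace IsAntipodalQuotient

variable {P : Type*} [TopologicalSpace P] {q q₀ q₁ q₂ : Disk → P}

theorem continuous (hq : IsAntipodalQuotient q) : Continuous q := hq.isQuotientMap.continuous

theorem norm_eq (hq : IsAntipodalQuotient q) {z w : Disk} (h : q z = q w) :
    ‖(z : ℂ)‖ = ‖(w : ℂ)‖ := by
  rcases (hq.eq_iff z w).1 h with rfl | ⟨_, h2⟩
  · rfl
  · rw [h2, norm_neg]

theorem eq_of_norm_lt (hq : IsAntipodalQuotient q) {z w : Disk} (h : q z = q w)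
    (hz : ‖(z : ℂ)‖ < 1) : z = w :=
  ((hq.eq_iff z w).1 h).resolve_right fun h2 => hz.ne h2.1

/-- Squaring is invariant under the antipodal map and identifies the image of the boundary with the
unit circle. -/
theorem exists_continuous_sq (hq : IsAntipodalQuotient q) :
    ∃ g : P → ℂ, Continuous g ∧ ∀ z : Disk, g (q z) = (z : ℂ) ^ 2 := by
  refine exists_lift_of_isQuotientMap hq.isQuotientMap (g := fun z : Disk => (z : ℂ) ^ 2)
    (by fun_prop) fun z w h => ?_
  rcases (hq.eq_iff z w).1 h with rfl | ⟨_, h2⟩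
  · rfl
  · simp [h2]

/-- `z²` determines `z` up to sign, and `(1 - ‖z‖) z` determines the sign exactly when `z` is
interior. Together they embed the quotient continuously and injectively in `ℂ × ℂ`. -/
theorem t2Space (hq : IsAntipodalQuotient q) : T2Space P := by
  obtain ⟨g, hg, hgq⟩ := hq.exists_continuous_sq
  obtain ⟨k, hk, hkq⟩ := exists_lift_of_isQuotientMap hq.isQuotientMap
    (g := fun z : Disk => (1 - (‖(z : ℂ)‖ : ℂ)) * z) (by fun_prop) (fun z w h => by
      rcases (hq.eq_iff z w).1 h with rfl | ⟨h1, h2⟩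
      · rfl
      · simp [h2, h1])
  refine T2Space.of_injective_continuous (f := fun x => (g x, k x)) ?_ (hg.prodMk hk)
  intro x y hxy
  obtain ⟨z, rfl⟩ := hq.isQuotientMap.surjective x
  obtain ⟨w, rfl⟩ := hq.isQuotientMap.surjective y
  have h1 := congrArg Prod.fst hxy
  have h2 := congrArg Prod.snd hxy
  simp only [hgq, hkq] at h1 h2
  rw [hq.eq_iff]
  rcases sq_eq_sq_iff_eq_or_eq_neg.1 h1 with h3 | h3
  · exact Or.inl (Subtype.ext h3)
  · rw [h3, norm_neg] at h2
    have h4 : (1 - (‖(w : ℂ)‖ : ℂ)) * w = 0 := by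
      linear_combination -h2 / 2
    rcases mul_eq_zero.1 h4 with h5 | h5
    · right
      have h6 : ‖(w : ℂ)‖ = 1 := by
        have : ((1 : ℝ) : ℂ) = (‖(w : ℂ)‖ : ℂ) := by simpa using sub_eq_zero.1 h5
        exact (Complex.ofReal_injective this).symm
      exact ⟨by rw [h3, norm_neg, h6], by rw [h3, neg_neg]⟩
    · left
      exact Subtype.ext (by rw [h3, h5, neg_zero])

/-- The curve `q ∘ turn` is injective modulo its period `1 / 2`; a quarter turn is half a period. -/
theorem turn_add_quarter_ne (hq : IsAntipodalQuotient q) (s : ℝ) :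
    q (Disk.turn (s + 1 / 4)) ≠ q (Disk.turn s) := by
  intro h
  rcases (hq.eq_iff _ _).1 h with h1 | ⟨_, h1⟩
  · exact Disk.turn_add_quarter_ne s h1
  · rw [← Disk.coe_turn_add_half] at h1
    obtain ⟨m, hm⟩ := Disk.turn_eq_turn.1 (Subtype.ext h1)
    have : ((4 * m : ℤ) : ℝ) = ((-3 : ℤ) : ℝ) := by push_cast; linarith
    have := Int.cast_injective this
    omega

theorem turn_add_half (hq : IsAntipodalQuotient q) (s : ℝ) :
    q (Disk.turn (s + 1 / 2)) = q (Disk.turn s) :=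
  ((hq.eq_iff _ _).2 (Or.inr ⟨Disk.norm_turn s, Disk.coe_turn_add_half s⟩)).symm

/-- A closed curve in the circle that is injective on the image of the boundary of the disk
in the projective plane is surjective. -/
theorem exists_eq_of_injective (hq : IsAntipodalQuotient q) {δ : ℝ → ℂ} (hδ : Continuous δ)
    (hn : ∀ s, ‖δ s‖ = 1) (h : ∀ s s', q (Disk.turn s) = q (Disk.turn s') ↔ δ s = δ s')
    {w : ℂ} (hw : ‖w‖ = 1) : ∃ s, δ s = w := by
  by_contra! hne
  have hw0 : w ≠ 0 := norm_ne_zero_iff.1 (by simp [hw])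
  have hnorm : ∀ s, ‖-δ s / w‖ = 1 := fun s => by rw [norm_div, norm_neg, hn, hw, div_one]
  -- As `δ` misses `w`, the curve `-δ / w` misses `-1`, so the principal argument is a continuous
  -- real-valued lift.
  have hslit : ∀ s, -δ s / w ∈ Complex.slitPlane := by
    intro s
    rw [Complex.mem_slitPlane_iff_arg]
    refine ⟨fun harg => ?_, norm_ne_zero_iff.1 (by rw [hnorm]; exact one_ne_zero)⟩
    have h1 := Complex.norm_mul_exp_arg_mul_I (-δ s / w)
    rw [hnorm, harg, Complex.exp_pi_mul_I, Complex.ofReal_one, one_mul, eq_div_iff hw0] at h1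
    exact hne s (by linear_combination h1)
  have hg : Continuous fun s => Complex.arg (-δ s / w) := by
    rw [continuous_iff_continuousAt]
    intro s
    exact (Complex.continuousAt_arg (hslit s)).comp (f := fun s => -δ s / w) (by fun_prop)
  set g : ℝ → ℝ := fun s => Complex.arg (-δ s / w) with hgdef
  have hper : g (0 + 1 / 4 + 1 / 4) = g 0 := by
    have h1 := hq.turn_add_half 0
    have h2 : δ (0 + 1 / 4 + 1 / 4) = δ 0 := by
      rw [← h, ← h1]; norm_num
    simp only [hgdef, h2]
  have hk : Continuous fun s => g (s + 1 / 4) - g s := by fun_prop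
  -- Since `g` has the same value at `0` and `1 / 2`, the difference takes opposite values at `0`
  -- and `1 / 4`.
  have hzero : ∃ s, g (s + 1 / 4) - g s = 0 := by
    rcases le_total (g (0 + 1 / 4) - g 0) 0 with h1 | h1
    · exact mem_range_of_exists_le_of_exists_ge hk ⟨0, h1⟩
        ⟨0 + 1 / 4, by rw [hper]; linarith⟩
    · exact mem_range_of_exists_le_of_exists_ge hk
        ⟨0 + 1 / 4, by rw [hper]; linarith⟩ ⟨0, h1⟩
  obtain ⟨s, hs⟩ := hzero
  have h2 : -δ (s + 1 / 4) / w = -δ s / w :=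
    Complex.ext_norm_arg (by rw [hnorm, hnorm]) (sub_eq_zero.1 hs)
  have h3 : δ (s + 1 / 4) = δ s := by
    rw [div_left_inj' hw0] at h2
    exact neg_injective h2
  exact hq.turn_add_quarter_ne s ((h _ _).2 h3)

/-- A closed curve inside another one fills it: the squaring function for `q₂` turns the boundary
curve of `q₁` into a curve in the unit circle to which `exists_eq_of_injective` applies. -/
theorem boundary_subset_symm (h₁ : IsAntipodalQuotient q₁) (h₂ : IsAntipodalQuotient q₂)
    (h : ∀ z : Disk, ‖(z : ℂ)‖ = 1 → ∃ w : Disk, ‖(w : ℂ)‖ = 1 ∧ q₁ z = q₂ w) (w : Disk)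
    (hw : ‖(w : ℂ)‖ = 1) : ∃ z : Disk, ‖(z : ℂ)‖ = 1 ∧ q₂ w = q₁ z := by
  obtain ⟨g, hg, hgq⟩ := h₂.exists_continuous_sq
  have hsq : ∀ z w : Disk, ‖(z : ℂ)‖ = 1 → (z : ℂ) ^ 2 = (w : ℂ) ^ 2 → q₂ z = q₂ w := by
    intro z w hz hzw
    rw [h₂.eq_iff]
    rcases sq_eq_sq_iff_eq_or_eq_neg.1 hzw with h3 | h3
    · exact Or.inl (Subtype.ext h3)
    · exact Or.inr ⟨hz, by rw [h3, neg_neg]⟩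
  have hc := h₁.continuous
  have ht := Disk.continuous_turn
  obtain ⟨s, hs⟩ := h₁.exists_eq_of_injective (δ := fun s => g (q₁ (Disk.turn s)))
    (by fun_prop) (fun s => by
      obtain ⟨v, hv, hv'⟩ := h _ (Disk.norm_turn s)
      rw [hv', hgq, norm_pow, hv, one_pow]) (fun s s' => by
      refine ⟨fun hh => by simp only [hh], fun hh => ?_⟩
      obtain ⟨v, hv, hv'⟩ := h _ (Disk.norm_turn s)
      obtain ⟨u, hu, hu'⟩ := h _ (Disk.norm_turn s')
      simp only [hv', hu', hgq] at hh ⊢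
      exact hsq _ _ hv hh) (w := (w : ℂ) ^ 2) (by rw [norm_pow, hw, one_pow])
  refine ⟨Disk.turn s, Disk.norm_turn s, ?_⟩
  obtain ⟨v, hv, hv'⟩ := h _ (Disk.norm_turn s)
  rw [hv'] at hs ⊢
  rw [hgq] at hs
  exact hsq _ _ hw hs.symm

/-- The same with an embedded disk `α` in place of `q₂`. As `α` is an embedding of a compact space,
the curve lifts continuously to the unit circle. -/
theorem boundary_subset_image (hq : IsAntipodalQuotient q) {α : Disk → P} (hα : Continuous α)
    (hinj : Function.Injective α)
    (h : ∀ z : Disk, ‖(z : ℂ)‖ = 1 → ∃ w : Disk, ‖(w : ℂ)‖ = 1 ∧ q z = α w) (w : Disk)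
    (hw : ‖(w : ℂ)‖ = 1) : ∃ z : Disk, ‖(z : ℂ)‖ = 1 ∧ α w = q z := by
  have := hq.t2Space
  have hemb : IsEmbedding α := (hα.isClosedEmbedding hinj).isEmbedding
  choose! v hv hv' using h
  have hc := hq.continuous
  have ht := Disk.continuous_turn
  have hvc : Continuous fun s => v (Disk.turn s) := by
    rw [hemb.continuous_iff]
    refine (hc.comp ht).congr fun s => ?_
    exact hv' _ (Disk.norm_turn s)
  obtain ⟨s, hs⟩ := hq.exists_eq_of_injective (δ := fun s => (v (Disk.turn s) : ℂ))
    (continuous_subtype_val.comp hvc) (fun s => hv _ (Disk.norm_turn s)) (fun s s' => by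
      rw [hv' _ (Disk.norm_turn s), hv' _ (Disk.norm_turn s'), hinj.eq_iff, Subtype.ext_iff]) hw
  refine ⟨Disk.turn s, Disk.norm_turn s, ?_⟩
  rw [hv' _ (Disk.norm_turn s)]
  exact congrArg α (Subtype.ext hs.symm)

/-- Over an interior point the lift is unique; over a boundary point there are two antipodal
candidates. The choice is forced by closing up the graph over the open disk. -/
theorem exists_continuous_lift (h₁ : IsAntipodalQuotient q₁) (h₂ : IsAntipodalQuotient q₂)
    (h : ∀ z : Disk, ‖(z : ℂ)‖ = 1 → ∃ w : Disk, ‖(w : ℂ)‖ = 1 ∧ q₁ z = q₂ w) :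
    ∃ l : Disk → Disk, Continuous l ∧ ∀ z, q₁ z = q₂ (l z) := by
  have := h₁.t2Space
  have hc₁ := h₁.continuous
  have hc₂ := h₂.continuous
  have hnorm : ∀ z w, q₁ z = q₂ w → (‖(z : ℂ)‖ = 1 ↔ ‖(w : ℂ)‖ = 1) := by
    intro z w hzw
    constructor
    · intro hz
      obtain ⟨v, hv, hv'⟩ := h z hz
      rw [h₂.norm_eq (hzw.symm.trans hv'), hv]
    · intro hw
      obtain ⟨v, hv, hv'⟩ := h₁.boundary_subset_symm h₂ h w hw
      rw [h₁.norm_eq (hzw.trans hv'), hv]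
  have hW : IsClosed {x : Disk × Disk | q₁ x.1 = q₂ x.2} :=
    isClosed_eq (by fun_prop) (by fun_prop)
  have hproj : ∀ K : Set Disk, IsClosed K → IsClosed {z | ∃ w ∈ K, q₁ z = q₂ w} := by
    intro K hK
    have : {z | ∃ w ∈ K, q₁ z = q₂ w}
        = Prod.fst '' ({x : Disk × Disk | q₁ x.1 = q₂ x.2} ∩ (Prod.snd ⁻¹' K)) := by
      ext z
      simp only [mem_ofPred_eq, mem_image, mem_inter_iff, mem_preimage, Prod.exists,
        exists_and_right, exists_eq_right]
      exact exists_congr fun w => and_comm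
    rw [this]
    exact ((hW.inter (hK.preimage continuous_snd)).isCompact.image continuous_fst).isClosed
  set Γ : Set (Disk × Disk) := closure {x | ‖(x.1 : ℂ)‖ < 1 ∧ q₁ x.1 = q₂ x.2} with hΓ
  have hΓW : ∀ z w, (z, w) ∈ Γ → q₁ z = q₂ w := by
    intro z w hzw
    exact closure_minimal (fun x (hx : _ ∧ _) => hx.2) hW hzw
  -- The projection of the compact set `Γ` is closed and contains the dense open disk.
  have hex : ∀ z, ∃ w, (z, w) ∈ Γ := by
    have hcl : IsClosed (Prod.fst '' Γ) :=
      (isClosed_closure.isCompact.image continuous_fst).isClosed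
    have hsub : {z : Disk | ‖(z : ℂ)‖ < 1} ⊆ Prod.fst '' Γ := by
      intro z hz
      obtain ⟨w, hw⟩ := h₂.isQuotientMap.surjective (q₁ z)
      exact ⟨(z, w), subset_closure ⟨hz, hw.symm⟩, rfl⟩
    intro z
    have hz := closure_minimal hsub hcl (Disk.dense_interior z)
    obtain ⟨⟨z', w⟩, hw, rfl⟩ := hz
    exact ⟨w, hw⟩
  have huniq : ∀ z w w', (z, w) ∈ Γ → (z, w') ∈ Γ → w = w' := by
    intro z w w' hw hw'
    have e := hΓW _ _ hw
    have e' := hΓW _ _ hw'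
    rcases (h₂.eq_iff w w').1 (e.symm.trans e') with h3 | ⟨hw1, hneg⟩
    · exact h3
    exfalso
    have hdist : dist w w' = 2 := by
      rw [Subtype.dist_eq, Complex.dist_eq, hneg, sub_neg_eq_add, ← two_mul, norm_mul, hw1]
      simp
    -- Near `z` all `q₂`-preimages lie close to `w` or to `w' = -w`. The part of a small ball inside
    -- the open disk is convex, so both alternatives, if they occur, occur at a common point `v`.
    have hout : IsClosed {z | ∃ v ∈ (Metric.ball w (1 / 2) ∪ Metric.ball w' (1 / 2))ᶜ,
        q₁ z = q₂ v} :=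
      hproj _ (Metric.isOpen_ball.union Metric.isOpen_ball).isClosed_compl
    have hzout : z ∈ {z | ∃ v ∈ (Metric.ball w (1 / 2) ∪ Metric.ball w' (1 / 2))ᶜ,
        q₁ z = q₂ v}ᶜ := by
      rintro ⟨v, hv, hv'⟩
      apply hv
      rcases (h₂.eq_iff w v).1 (e.symm.trans hv') with rfl | ⟨_, h4⟩
      · exact Or.inl (Metric.mem_ball_self (by norm_num))
      · have : v = w' := Subtype.ext (h4.trans hneg.symm)
        rw [this]
        exact Or.inr (Metric.mem_ball_self (by norm_num))
    obtain ⟨ε, hε, hball⟩ := Metric.isOpen_iff.1 hout.isOpen_compl z hzout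
    have hconn : IsPreconnected {v : Disk | v ∈ Metric.ball z ε ∧ ‖(v : ℂ)‖ < 1} := by
      refine Disk.isPreconnected_of_convex
        ((convex_ball (z : ℂ) ε).inter (convex_ball (0 : ℂ) 1)) fun x => ?_
      constructor
      · rintro ⟨hx1, hx2⟩
        rw [mem_ball_zero_iff] at hx2
        exact ⟨mem_closedBall_zero_iff.2 hx2.le, hx1, hx2⟩
      · rintro ⟨_, hx1, hx2⟩
        exact ⟨hx1, mem_ball_zero_iff.2 hx2⟩
    have hmeet : ∀ u, (z, u) ∈ Γ → ({v : Disk | v ∈ Metric.ball z ε ∧ ‖(v : ℂ)‖ < 1} ∩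
        {z | ∃ v ∈ Metric.closedBall u (1 / 2), q₁ z = q₂ v}).Nonempty := by
      intro u hu
      have hopen : IsOpen (Metric.ball z ε ×ˢ Metric.ball u (1 / 2)) :=
        Metric.isOpen_ball.prod Metric.isOpen_ball
      obtain ⟨⟨v, v'⟩, ⟨hv1, hv2⟩, hv3, hv4⟩ := mem_closure_iff.1 hu _ hopen
        ⟨Metric.mem_ball_self hε, Metric.mem_ball_self (by norm_num)⟩
      exact ⟨v, ⟨hv1, hv3⟩, v', Metric.ball_subset_closedBall hv2, hv4⟩
    obtain ⟨v, ⟨_, hv1⟩, ⟨x, hx, hx'⟩, ⟨y, hy, hy'⟩⟩ := isPreconnected_closed_iff.1 hconn _ _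
      (hproj (Metric.closedBall w (1 / 2)) Metric.isClosed_closedBall)
      (hproj (Metric.closedBall w' (1 / 2)) Metric.isClosed_closedBall)
      (by
        rintro v ⟨hv1, _⟩
        obtain ⟨x, hx⟩ := h₂.isQuotientMap.surjective (q₁ v)
        have hx1 : x ∈ Metric.ball w (1 / 2) ∪ Metric.ball w' (1 / 2) := by
          by_contra hx1
          exact hball hv1 ⟨x, hx1, hx.symm⟩
        rcases hx1 with hx1 | hx1
        · exact Or.inl ⟨x, Metric.ball_subset_closedBall hx1, hx.symm⟩
        · exact Or.inr ⟨x, Metric.ball_subset_closedBall hx1, hx.symm⟩)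
      (hmeet w hw) (hmeet w' hw')
    -- As `v` is interior, so are its preimages; hence there is only one, and it would lie within `1
    -- / 2` of two points at distance `2`.
    have hx1 : ‖(x : ℂ)‖ < 1 :=
      lt_of_le_of_ne x.norm_le_one fun h5 => hv1.ne ((hnorm _ _ hx').2 h5)
    have hxy : x = y := h₂.eq_of_norm_lt (hx'.symm.trans hy') hx1
    subst hxy
    have := dist_triangle_left w w' x
    rw [Metric.mem_closedBall] at hx hy
    linarith
  choose l hl using hex
  refine ⟨l, continuous_iff_isClosed.2 fun K hK => ?_, fun z => hΓW _ _ (hl z)⟩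
  have : l ⁻¹' K = Prod.fst '' (Γ ∩ (Prod.snd ⁻¹' K)) := by
    ext z
    constructor
    · intro hz
      exact ⟨(z, l z), ⟨hl z, hz⟩, rfl⟩
    · rintro ⟨⟨z', w⟩, ⟨hw, hwK⟩, rfl⟩
      have := huniq _ _ _ (hl z') hw
      rw [mem_preimage, this]
      exact hwK
  rw [this]
  exact ((isClosed_closure.inter (hK.preimage continuous_snd)).isCompact.image
    continuous_fst).isClosed

/-- Two maps that exhibit a space as the disk with opposite boundary points glued differ by a
homeomorphism of the disk if the image of the boundary under one contains that under the other. -/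
theorem exists_homeomorph (h₁ : IsAntipodalQuotient q₁) (h₂ : IsAntipodalQuotient q₂)
    (h : ∀ z : Disk, ‖(z : ℂ)‖ = 1 → ∃ w : Disk, ‖(w : ℂ)‖ = 1 ∧ q₁ z = q₂ w) :
    ∃ l : Disk ≃ₜ Disk, q₁ = q₂ ∘ l := by
  have key : ∀ {q q' : Disk → P}, IsAntipodalQuotient q → ∀ {l l' : Disk → Disk}, Continuous l →
      Continuous l' → (∀ z, q z = q' (l z)) → (∀ z, q' z = q (l' z)) → ∀ z, l' (l z) = z := by
    intro q q' hq l l' hl hl' e e'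
    have := Continuous.ext_on Disk.dense_interior (hl'.comp hl) continuous_id fun z hz =>
      (hq.eq_of_norm_lt ((e z).trans (e' (l z))) hz).symm
    exact fun z => congrFun this z
  obtain ⟨l, hl, e⟩ := h₁.exists_continuous_lift h₂ h
  obtain ⟨l', hl', e'⟩ := h₂.exists_continuous_lift h₁ (h₁.boundary_subset_symm h₂ h)
  exact ⟨⟨⟨l, l', key h₁ hl hl' e e', key h₂ hl' hl e' e⟩, hl, hl'⟩, funext e⟩

/-- The image of the boundary is a circle traversed once per half turn. Without the point `v` it is
the image of an open arc of half a turn, or of the whole line if `v` is not on it. -/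
theorem isPreconnected_boundary_diff (hq : IsAntipodalQuotient q) (v : P) :
    IsPreconnected {x | x ≠ v ∧ ∃ z : Disk, ‖(z : ℂ)‖ = 1 ∧ q z = x} := by
  have hc : Continuous fun s => q (Disk.turn s) := hq.continuous.comp Disk.continuous_turn
  by_cases hv : ∃ z : Disk, ‖(z : ℂ)‖ = 1 ∧ q z = v
  · obtain ⟨z, hz, rfl⟩ := hv
    obtain ⟨s₀, rfl⟩ := Disk.exists_turn hz
    have : {x | x ≠ q (Disk.turn s₀) ∧ ∃ z : Disk, ‖(z : ℂ)‖ = 1 ∧ q z = x}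
        = (fun s => q (Disk.turn s)) '' Ioo s₀ (s₀ + 1 / 2) := by
      ext x
      constructor
      · rintro ⟨hne, z, hz, rfl⟩
        obtain ⟨s, rfl⟩ := Disk.exists_turn hz
        have hper : ∀ (s : ℝ) (m : ℤ), q (Disk.turn (s + m * (1 / 2))) = q (Disk.turn s) := by
          intro s m
          have hp : Function.Periodic (fun s => q (Disk.turn s)) (1 / 2) := hq.turn_add_half
          exact hp.int_mul m s
        set u : ℝ := 2 * (s - s₀) with hu
        have hs : s = s₀ + Int.fract u / 2 + ⌊u⌋ * (1 / 2) := by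
          have := Int.fract_add_floor u
          linarith
        refine ⟨s₀ + Int.fract u / 2, ⟨?_, ?_⟩, ?_⟩
        · have h0 := Int.fract_nonneg u
          have h1 : Int.fract u ≠ 0 := by
            intro h1
            apply hne
            rw [hs, hper, h1]
            simp
          have : 0 < Int.fract u := lt_of_le_of_ne h0 h1.symm
          linarith
        · have := Int.fract_lt_one u
          linarith
        · change q (Disk.turn _) = _
          rw [← hper _ ⌊u⌋, ← hs]
      · rintro ⟨s, ⟨h1, h2⟩, rfl⟩
        refine ⟨fun h => ?_, _, Disk.norm_turn s, rfl⟩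
        rcases (hq.eq_iff _ _).1 h with h3 | ⟨_, h3⟩
        · obtain ⟨m, hm⟩ := Disk.turn_eq_turn.1 h3
          have e1 : (0 : ℝ) < m := by linarith
          have e2 : (m : ℝ) < 1 := by linarith
          have e1' : 0 < m := by exact_mod_cast e1
          have e2' : m < 1 := by exact_mod_cast e2
          omega
        · rw [← Disk.coe_turn_add_half] at h3
          obtain ⟨m, hm⟩ := Disk.turn_eq_turn.1 (Subtype.ext h3)
          have e1 : (-1 : ℝ) < m := by linarith
          have e2 : (m : ℝ) < 0 := by linarith
          have e1' : -1 < m := by exact_mod_cast e1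
          have e2' : m < 0 := by exact_mod_cast e2
          omega
    rw [this]
    exact isPreconnected_Ioo.image _ hc.continuousOn
  · have : {x | x ≠ v ∧ ∃ z : Disk, ‖(z : ℂ)‖ = 1 ∧ q z = x}
        = (fun s => q (Disk.turn s)) '' univ := by
      ext x
      constructor
      · rintro ⟨_, z, hz, rfl⟩
        obtain ⟨s, rfl⟩ := Disk.exists_turn hz
        exact ⟨s, mem_univ _, rfl⟩
      · rintro ⟨s, _, rfl⟩
        exact ⟨fun h => hv ⟨_, Disk.norm_turn s, h⟩, _, Disk.norm_turn s, rfl⟩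
    rw [this]
    exact isPreconnected_univ.image _ hc.continuousOn

/-- If the image of the boundary under `q` lies in the union of the boundary of a petal `p` and
a closed set `F` that meets the petal in its base point only, then it lies in `F`: the boundary
of a petal separates the projective plane. -/
theorem boundary_subset_of_petal (h₀ : IsAntipodalQuotient q₀) (hq : IsAntipodalQuotient q)
    {p : Disk → Disk} (hp : Continuous p) (hinj : Function.Injective p) {R F : Set Disk}
    (hR : IsClosed R) (hF : IsClosed F) (hcover : ∀ x, x ∈ R ∨ ∃ y, p y = x)
    (hRp : ∀ y, p y ∈ R → ‖(y : ℂ)‖ = 1) (hbF : ∀ x : Disk, ‖(x : ℂ)‖ = 1 → x ∈ F)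
    (hFp : ∀ y, p y ∈ F → y = Disk.turn 0) (hpF : p (Disk.turn 0) ∈ F)
    (h : ∀ z : Disk, ‖(z : ℂ)‖ = 1 →
      (∃ y : Disk, ‖(y : ℂ)‖ = 1 ∧ q z = q₀ (p y)) ∨ ∃ x ∈ F, q z = q₀ x)
    (z : Disk) (hz : ‖(z : ℂ)‖ = 1) : ∃ x ∈ F, q z = q₀ x := by
  have := hq.t2Space
  have hc₀ := h₀.continuous
  by_contra hzF
  have hpb : ∀ y, ‖(p y : ℂ)‖ = 1 → y = Disk.turn 0 := fun y hy => hFp y (hbF _ hy)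
  have hglue : ∀ x y, q₀ x = q₀ (p y) → x = p y ∨ ‖(x : ℂ)‖ = 1 ∧ y = Disk.turn 0 := by
    intro x y hxy
    rcases (h₀.eq_iff _ _).1 hxy with h1 | ⟨h1, h2⟩
    · exact Or.inl h1
    · exact Or.inr ⟨h1, hpb y (by rw [h2, norm_neg, h1])⟩
  have hinj₀ : Function.Injective fun y => q₀ (p y) := by
    intro y y' hy
    rcases hglue _ _ hy with h1 | ⟨h1, h2⟩
    · exact hinj h1
    · rw [h2, hpb y h1]
  have hA2 : IsClosed ((fun y => q₀ (p y)) '' univ) :=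
    (isCompact_univ.image (hc₀.comp hp)).isClosed
  set v := q₀ (p (Disk.turn 0)) with hv
  -- Off the base point `v`, the images of `F` and of the petal are disjoint closed sets covering
  -- the connected rest of the curve. It reaches the petal at `q z`, so no point of it can lie in
  -- `F` alone.
  have hcurve : ∀ z : Disk, ‖(z : ℂ)‖ = 1 →
      ∃ y : Disk, ‖(y : ℂ)‖ = 1 ∧ q z = q₀ (p y) := by
    intro w hw
    by_contra hwp
    obtain ⟨x, hx, hx'⟩ := (h w hw).resolve_left hwp
    obtain ⟨y, hy, hy'⟩ := (h z hz).resolve_right hzF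
    obtain ⟨u, ⟨hu, _⟩, ⟨x', hx1, rfl⟩, ⟨y', _, hy1⟩⟩ :=
      isPreconnected_closed_iff.1 (hq.isPreconnected_boundary_diff v)
      (q₀ '' F) _ ((hF.isCompact.image hc₀).isClosed) hA2 (by
        rintro _ ⟨_, t, ht, rfl⟩
        rcases h t ht with ⟨y, hy, hy'⟩ | ⟨x, hx, hx'⟩
        · exact Or.inr ⟨y, mem_univ _, hy'.symm⟩
        · exact Or.inl ⟨x, hx, hx'.symm⟩)
      ⟨q w, ⟨fun e => hwp ⟨_, Disk.norm_turn 0, e⟩, w, hw, rfl⟩, x, hx, hx'.symm⟩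
      ⟨q z, ⟨fun e => hzF ⟨_, hpF, e⟩, z, hz, rfl⟩, y, mem_univ _, hy'.symm⟩
    rcases hglue _ _ hy1.symm with h1 | ⟨_, h1⟩
    · have := hFp y' (h1 ▸ hx1)
      exact hu (by rw [← hy1, this])
    · exact hu (by rw [← hy1, h1])
  have hcurve' := hq.boundary_subset_image (hc₀.comp hp) hinj₀ hcurve
  -- The curve is now all of the petal boundary. Its complement is `q` of the open disk, hence
  -- connected.
  have hconn : IsPreconnected (q '' {z : Disk | ‖(z : ℂ)‖ < 1}) := by
    refine IsPreconnected.image (Disk.isPreconnected_of_convex (convex_ball (0 : ℂ) 1)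
      fun x => ?_) _ hq.continuous.continuousOn
    constructor
    · intro hx
      rw [mem_ball_zero_iff] at hx
      exact ⟨mem_closedBall_zero_iff.2 hx.le, hx⟩
    · rintro ⟨_, hx⟩
      exact mem_ball_zero_iff.2 hx
  have hmem : ∀ u, (∀ y : Disk, ‖(y : ℂ)‖ = 1 → u ≠ q₀ (p y)) →
      u ∈ q '' {z : Disk | ‖(z : ℂ)‖ < 1} := by
    intro u hu
    obtain ⟨w, rfl⟩ := hq.isQuotientMap.surjective u
    refine ⟨w, lt_of_le_of_ne w.norm_le_one fun hw => ?_, rfl⟩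
    obtain ⟨y, hy, hy'⟩ := hcurve w hw
    exact hu y hy hy'
  -- Two boundary points a quarter turn apart have different images, so one of them is not `v`; it
  -- witnesses the part outside the petal.
  have hx₀ : ∃ x : Disk, ‖(x : ℂ)‖ = 1 ∧ q₀ x ≠ v := by
    by_cases h0 : q₀ (Disk.turn 0) = v
    · exact ⟨_, Disk.norm_turn (0 + 1 / 4), fun h1 => h₀.turn_add_quarter_ne 0 (h1.trans h0.symm)⟩
    · exact ⟨_, Disk.norm_turn 0, h0⟩
  obtain ⟨x₀, hx₀, hx₀v⟩ := hx₀
  have hx₀p : ∀ y, q₀ x₀ ≠ q₀ (p y) := by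
    intro y hy
    have : y = Disk.turn 0 := by
      rcases hglue _ _ hy with h1 | ⟨_, h1⟩
      · exact hpb y (h1 ▸ hx₀)
      · exact h1
    exact hx₀v (by rw [hy, this])
  let o : Disk := ⟨0, Metric.mem_closedBall_self zero_le_one⟩
  -- `R` and the petal cover the plane and overlap only along the petal boundary, while `x₀` and the
  -- centre `o` of the petal lie on different sides: the complement of the curve would be
  -- disconnected.
  obtain ⟨u, ⟨w, hw, rfl⟩, ⟨x, hx, hxw⟩, ⟨y, _, hy⟩⟩ := isPreconnected_closed_iff.1 hconn
    (q₀ '' R) _ ((hR.isCompact.image hc₀).isClosed) hA2 (by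
      rintro u -
      obtain ⟨x, rfl⟩ := h₀.isQuotientMap.surjective u
      rcases hcover x with hx | ⟨y, rfl⟩
      · exact Or.inl ⟨x, hx, rfl⟩
      · exact Or.inr ⟨y, mem_univ _, rfl⟩)
    ⟨q₀ x₀, hmem _ fun y _ => hx₀p y, x₀,
      (hcover x₀).resolve_right fun ⟨y, hy⟩ => hx₀p y (by rw [hy]), rfl⟩
    ⟨q₀ (p o), hmem _ fun y hy e => by
      have : o = y := hinj₀ e
      rw [← this] at hy
      simp [o] at hy, o, mem_univ _, rfl⟩
  have hy1 : ‖(y : ℂ)‖ = 1 := by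
    rcases hglue _ _ (hxw.trans hy.symm) with h1 | ⟨_, h1⟩
    · exact hRp y (h1 ▸ hx)
    · rw [h1, Disk.norm_turn]
  obtain ⟨w', hw', e⟩ := hcurve' y hy1
  have e2 : q w = q w' := hy.symm.trans e
  have : ‖(w : ℂ)‖ = 1 := (hq.norm_eq e2).trans hw'
  exact hw.ne this

end IsAntipodalQuotient

/-! ### Collapses from piecewise linear functions -/

/-- The extension of a function on the unit interval to a map of degree one. -/
noncomputable def periodize (c : ℝ → ℝ) (s : ℝ) : ℝ := ⌊s⌋ + c (Int.fract s)

theorem periodize_add_int {c : ℝ → ℝ} (h0 : c 0 = 0) (h1 : c 1 = 1) {x : ℝ} (hx0 : 0 ≤ x)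
    (hx1 : x ≤ 1) (m : ℤ) : periodize c (x + m) = c x + m := by
  rw [periodize, Int.floor_add_intCast, Int.fract_add_intCast]
  rcases hx1.lt_or_eq with h | rfl
  · rw [Int.floor_eq_zero_iff.2 ⟨hx0, h⟩, Int.fract_eq_self.2 ⟨hx0, h⟩]
    push_cast; ring
  · rw [Int.floor_one, Int.fract_one, h0, h1]
    push_cast; ring

/-- `hwrap` forbids arcs touching both `0` and `1`: such arcs would meet after periodization. -/
theorem isCollapse_periodize {J : Type*} {c : ℝ → ℝ} {a b : J → ℝ} (hcont : Continuous c)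
    (hmono : Monotone c) (h0 : c 0 = 0) (h1 : c 1 = 1) (ha : ∀ j, 0 ≤ a j) (hb : ∀ j, b j ≤ 1)
    (hlt : ∀ j, a j < b j) (hconst : ∀ j, c (a j) = c (b j))
    (heq : ∀ x x', 0 ≤ x → x < x' → x' ≤ 1 → c x = c x' → ∃ j, a j ≤ x ∧ x' ≤ b j)
    (hdisj : ∀ x j k, x ∈ Icc (a j) (b j) → x ∈ Icc (a k) (b k) → j = k)
    (hwrap : ∀ j k, 0 < a j ∨ b k < 1) : IsCollapse (periodize c) a b := by
  have hper : ∀ (s : ℝ) (m : ℤ), periodize c (s + m) = periodize c s + m := by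
    intro s m
    rw [periodize, periodize, Int.floor_add_intCast, Int.fract_add_intCast]
    push_cast; ring
  have hunit : ∀ x, 0 ≤ x → x ≤ 1 → periodize c x = c x := by
    intro x hx0 hx1
    simpa using periodize_add_int h0 h1 hx0 hx1 0
  have hc0 : ∀ s : ℝ, 0 ≤ c (Int.fract s) := fun s => h0 ▸ hmono (Int.fract_nonneg s)
  have hc1 : ∀ s : ℝ, c (Int.fract s) ≤ 1 := fun s => h1 ▸ hmono (Int.fract_lt_one s).le
  have hfl : ∀ s : ℝ, Int.fract s = s - ⌊s⌋ := fun s => rfl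
  refine ⟨?_, ?_, ?_, hlt, ?_, ?_, ?_⟩
  · have h2 : Continuous fun s : ℝ => c (Int.fract s) - Int.fract s := by
      refine ContinuousOn.comp_fract'' (f := fun x => c x - x) (by fun_prop) ?_
      rw [h0, h1]; norm_num
    have h3 : periodize c = fun s => s + (c (Int.fract s) - Int.fract s) := by
      ext s
      rw [periodize, hfl]; ring
    rw [h3]
    exact continuous_id.add h2
  · intro s s' hs
    rw [periodize, periodize]
    rcases (Int.floor_mono hs).lt_or_eq with h | h
    · have h2 : (⌊s⌋ : ℝ) + 1 ≤ ⌊s'⌋ := by exact_mod_cast h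
      linarith [hc0 s', hc1 s]
    · rw [h]
      have : c (Int.fract s) ≤ c (Int.fract s') := hmono (by rw [hfl, hfl, h]; linarith)
      linarith
  · intro s
    simpa using hper s 1
  · intro j
    rw [hunit _ (ha j) ((hlt j).le.trans (hb j)), hunit _ ((ha j).trans (hlt j).le) (hb j),
      hconst]
  · have key : ∀ s s' : ℝ, s < s' → periodize c s = periodize c s' → ∃ (j : J) (m : ℤ),
        s ∈ Icc (a j + m) (b j + m) ∧ s' ∈ Icc (a j + m) (b j + m) := by
      intro s s' hs h
      rw [periodize, periodize] at h
      rcases (Int.floor_mono hs.le).lt_or_eq with hf | hf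
      -- Across an integer, equality forces `c` to be `1` at the fractional part of `s` and `0` at
      -- that of `s'`. By `hwrap` this is only possible if `s'` is the integer itself, the right end
      -- of an arc.
      · have h2 : (⌊s⌋ : ℝ) + 1 ≤ ⌊s'⌋ := by exact_mod_cast hf
        have e1 := hc0 s'
        have e2 := hc1 s
        have e3 : c (Int.fract s) = c 1 := by rw [h1]; linarith
        have e4 : c 0 = c (Int.fract s') := by rw [h0]; linarith
        have e5 : (⌊s'⌋ : ℝ) = ⌊s⌋ + 1 := by linarith
        obtain ⟨j, hj1, hj2⟩ := heq _ _ (Int.fract_nonneg s) (Int.fract_lt_one s) le_rfl e3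
        rcases (Int.fract_nonneg s').lt_or_eq with h3 | h3
        · obtain ⟨k, hk1, hk2⟩ := heq _ _ le_rfl h3 (Int.fract_lt_one s').le e4
          rcases hwrap k j with h4 | h4 <;> linarith
        · have e6 := hfl s
          have e7 := hfl s'
          have e8 := Int.fract_lt_one s
          have e9 := hb j
          exact ⟨j, ⌊s⌋, ⟨by linarith, by linarith⟩, ⟨by linarith, by linarith⟩⟩
      · rw [hf] at h
        have e6 := hfl s
        have e7 := hfl s'
        rw [hf] at e6
        obtain ⟨j, hj1, hj2⟩ := heq _ _ (Int.fract_nonneg s) (by linarith)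
          (Int.fract_lt_one s').le (add_left_cancel h)
        exact ⟨j, ⌊s'⌋, ⟨by linarith, by linarith⟩, ⟨by linarith, by linarith⟩⟩
    intro s s' h
    rcases lt_trichotomy s s' with hs | hs | hs
    · exact Or.inr (key s s' hs h)
    · exact Or.inl hs
    · obtain ⟨j, m, e1, e2⟩ := key s' s hs h.symm
      exact Or.inr ⟨j, m, e2, e1⟩
  · intro s j k l m hj hk
    have key : ∀ (j k : J) (l m : ℤ), s ∈ Icc (a j + l) (b j + l) →
        s ∈ Icc (a k + m) (b k + m) → ¬ l < m := by
      intro j k l m hj hk hlm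
      have h2 : (l : ℝ) + 1 ≤ m := by exact_mod_cast hlm
      have e1 := ha k
      have e2 := hb j
      rcases hwrap k j with h3 | h3 <;> linarith [hj.2, hk.1]
    obtain rfl : l = m := le_antisymm (not_lt.1 (key k j m l hk hj)) (not_lt.1 (key j k l m hj hk))
    refine ⟨hdisj (s - l) j k ⟨?_, ?_⟩ ⟨?_, ?_⟩, rfl⟩ <;> linarith [hj.1, hj.2, hk.1, hk.2]

theorem IsCollapse.add_const {J : Type*} {c : ℝ → ℝ} {a b : J → ℝ} (hc : IsCollapse c a b)
    (e : ℝ) : IsCollapse (fun s => c s + e) a b where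
  continuous := hc.continuous.add continuous_const
  monotone := hc.monotone.add_const e
  add_one s := by rw [hc.add_one]; ring
  lt := hc.lt
  const j := by rw [hc.const j]
  eq_imp s s' h := hc.eq_imp s s' (add_right_cancel h)
  disjoint := hc.disjoint

/-- Rotates the source, as `add_const` rotates the target; the pieces of the Girl's surface must be
aligned before they are glued. -/
theorem IsCollapse.comp_add {J : Type*} {c : ℝ → ℝ} {a b : J → ℝ} (hc : IsCollapse c a b)
    (d : ℝ) : IsCollapse (fun s => c (s + d)) (fun j => a j - d) (fun j => b j - d) where
  continuous := hc.continuous.comp (continuous_add_const d)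
  monotone s s' h := hc.monotone (add_le_add_left h d)
  add_one s := by
    rw [← hc.add_one, add_right_comm]
  lt j := by linarith [hc.lt j]
  const j := by simpa using hc.const j
  eq_imp s s' h := by
    rcases hc.eq_imp (s + d) (s' + d) h with h1 | ⟨j, m, h1, h2⟩
    · exact Or.inl (add_right_cancel h1)
    · refine Or.inr ⟨j, m, ⟨?_, ?_⟩, ⟨?_, ?_⟩⟩ <;> linarith [h1.1, h1.2, h2.1, h2.2]
  disjoint s j k l m hj hk :=
    hc.disjoint (s + d) j k l m ⟨by linarith [hj.1], by linarith [hj.2]⟩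
      ⟨by linarith [hk.1], by linarith [hk.2]⟩

/-- The clamping function onto the unit interval. -/
noncomputable def clamp (x : ℝ) : ℝ := max 0 (min 1 x)

theorem clamp_of_nonpos {x : ℝ} (h : x ≤ 0) : clamp x = 0 :=
  max_eq_left ((min_le_right _ _).trans h)

theorem clamp_of_one_le {x : ℝ} (h : 1 ≤ x) : clamp x = 1 := by
  rw [clamp, min_eq_left h, max_eq_right zero_le_one]

theorem clamp_of_mem {x : ℝ} (h0 : 0 ≤ x) (h1 : x ≤ 1) : clamp x = x := by
  rw [clamp, min_eq_right h1, max_eq_right h0]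

theorem continuous_clamp : Continuous clamp := by
  unfold clamp; fun_prop

theorem monotone_clamp : Monotone clamp := fun _ _ h => max_le_max le_rfl (min_le_min le_rfl h)

/-- `clamp` is strictly increasing on the unit interval, so the interval from `x` to `y` cannot
overlap its interior. -/
theorem of_clamp_eq {x y : ℝ} (hxy : x < y) (h : clamp x = clamp y) : y ≤ 0 ∨ 1 ≤ x := by
  by_contra! hne
  rcases le_total x 0 with h1 | h1 <;> rcases le_total y 1 with h2 | h2
  · rw [clamp_of_nonpos h1, clamp_of_mem hne.1.le h2] at h; linarith
  · rw [clamp_of_nonpos h1, clamp_of_one_le h2] at h; linarith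
  · rw [clamp_of_mem h1 hne.2.le, clamp_of_mem hne.1.le h2] at h; linarith
  · rw [clamp_of_mem h1 hne.2.le, clamp_of_one_le h2] at h; linarith

/-! ### Closed curves and petals -/

namespace IsPetalDecomposition

variable {J : Type*} {c : ℝ → ℝ} {a b : J → ℝ} {n : Disk → Disk} {p : J → Disk → Disk}

theorem petal_injective (h : IsPetalDecomposition c a b n p) (j : J) :
    Function.Injective (p j) := fun y y' hy => (h.petal_eq_petal j j y y' hy).2

theorem petal_base (h : IsPetalDecomposition c a b n p) (hc : IsCollapse c a b) (j : J) :
    p j (Disk.turn 0) = Disk.turn (c (a j)) := by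
  have h1 := h.core_arc j 0
  have h2 := hc.left_notMem j 0
  simp only [Set.Icc.coe_zero, mul_zero, add_zero, Int.cast_zero] at h1 h2
  rw [← h1, h.core_turn _ h2]

theorem core_boundary (h : IsPetalDecomposition c a b n p) {x : Disk} (hx : ‖(x : ℂ)‖ = 1) :
    ‖(n x : ℂ)‖ = 1 ∨ ∃ (j : J) (y : Disk), ‖(y : ℂ)‖ = 1 ∧ n x = p j y := by
  obtain ⟨s, rfl⟩ := Disk.exists_turn hx
  by_cases hs : s ∈ openArcs a b
  · right
    obtain ⟨j, m, h1, h2⟩ := hs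
    have h4 : 0 < b j - a j := by linarith
    let t : I := ⟨(s - m - a j) / (b j - a j), div_nonneg (by linarith) h4.le,
      (div_le_one h4).2 (by linarith)⟩
    refine ⟨j, Disk.turn t, Disk.norm_turn _, ?_⟩
    rw [← h.core_arc]
    have : s = a j + (b j - a j) * t + m := by
      change s = a j + (b j - a j) * ((s - m - a j) / (b j - a j)) + m
      rw [mul_div_cancel₀ _ h4.ne']; ring
    conv_lhs => rw [this, Disk.turn_add_int]
  · left
    rw [h.core_turn s hs, Disk.norm_turn]

/-- A closed curve in the projective plane that does not separate it and lies in the union of the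
boundaries of the disk, of a smaller disk `e` and of the petals of that disk avoids the
petals. -/
theorem boundary_subset [Finite J] {P : Type*} [TopologicalSpace P] {q₀ q : Disk → P}
    (h : IsPetalDecomposition c a b n p) (hc : IsCollapse c a b)
    (h₀ : IsAntipodalQuotient q₀) (hq : IsAntipodalQuotient q) {e : Disk → Disk}
    (he : Continuous e) (hinj : Function.Injective e) {N : Set Disk} (hN : IsClosed N)
    (hcover : ∀ x, x ∈ N ∨ ∃ y, e y = x) (hNe : ∀ y, e y ∈ N → ‖(y : ℂ)‖ = 1)
    (heb : ∀ y, ‖(e y : ℂ)‖ = 1 → ‖(y : ℂ)‖ = 1)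
    (hcurve : ∀ z : Disk, ‖(z : ℂ)‖ = 1 → ∃ x, q z = q₀ x ∧ (‖(x : ℂ)‖ = 1 ∨
      ∃ w, x = e w ∧ (‖(w : ℂ)‖ = 1 ∨ ∃ (j : J) (y : Disk), ‖(y : ℂ)‖ = 1 ∧ w = p j y)))
    (z : Disk) (hz : ‖(z : ℂ)‖ = 1) :
    ∃ x, q z = q₀ x ∧ (‖(x : ℂ)‖ = 1 ∨ ∃ w, x = e w ∧ ‖(w : ℂ)‖ = 1) := by
  have hb : IsClosed {x : Disk | ‖(x : ℂ)‖ = 1} := isClosed_eq (by fun_prop) continuous_const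
  have hclosed : ∀ (l : Disk → Disk) (K : Set Disk), Continuous l → IsClosed K →
      IsClosed (l '' K) := fun l K hl hK => (hK.isCompact.image hl).isClosed
  have hother : ∀ j, IsClosed (⋃ k : {k // k ≠ j}, p k.1 '' univ) := fun j =>
    isClosed_iUnion_of_finite fun k => hclosed _ _ (h.continuous_petal k.1) isClosed_univ
  have hmem_other : ∀ j y, p j y ∉ ⋃ k : {k // k ≠ j}, p k.1 '' univ := by
    intro j y hy
    obtain ⟨⟨k, hk⟩, y', -, hy'⟩ := mem_iUnion.1 hy
    exact hk (h.petal_eq_petal _ _ _ _ hy').1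
  -- Each petal is excluded separately; the other petals are filled in and added to the closed set
  -- `F`.
  have hexcl : ∀ j, ∀ z : Disk, ‖(z : ℂ)‖ = 1 → ∃ x ∈ {x : Disk | ‖(x : ℂ)‖ = 1} ∪
      e '' ({x : Disk | ‖(x : ℂ)‖ = 1} ∪ ⋃ k : {k // k ≠ j}, p k.1 '' univ), q z = q₀ x := by
    intro j
    refine h₀.boundary_subset_of_petal hq (p := fun y => e (p j y))
      (R := N ∪ e '' (n '' univ ∪ ⋃ k : {k // k ≠ j}, p k.1 '' univ))
      (he.comp (h.continuous_petal j)) (hinj.comp (h.petal_injective j))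
      (hN.union (hclosed _ _ he ((hclosed _ _ h.continuous_core isClosed_univ).union (hother j))))
      (hb.union (hclosed _ _ he (hb.union (hother j)))) ?_ ?_ ?_ ?_ ?_ ?_
    · intro x
      rcases hcover x with hx | ⟨y, rfl⟩
      · exact Or.inl (Or.inl hx)
      rcases h.surjective y with ⟨w, rfl⟩ | ⟨k, w, rfl⟩
      · exact Or.inl (Or.inr ⟨_, Or.inl ⟨w, mem_univ _, rfl⟩, rfl⟩)
      · by_cases hk : k = j
        · subst hk; exact Or.inr ⟨w, rfl⟩
        · exact Or.inl (Or.inr ⟨_, Or.inr (mem_iUnion.2 ⟨⟨k, hk⟩, w, mem_univ _, rfl⟩), rfl⟩)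
    · rintro y (hy | ⟨w, hw, hw'⟩)
      · rw [h.petal_boundary j y (hNe _ hy), Disk.norm_turn]
      · obtain rfl := hinj hw'
        rcases hw with ⟨x, -, hx⟩ | hw
        · obtain ⟨t, -, rfl⟩ := h.core_eq_petal _ _ _ hx
          exact Disk.norm_turn _
        · exact absurd hw (hmem_other j y)
    · exact fun x hx => Or.inl hx
    · rintro y (hy | ⟨w, hw, hw'⟩)
      · exact h.petal_boundary j y (heb _ hy)
      · obtain rfl := hinj hw'
        rcases hw with hw | hw
        · exact h.petal_boundary j y hw
        · exact absurd hw (hmem_other j y)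
    · refine Or.inr ⟨_, Or.inl ?_, rfl⟩
      change ‖(p j (Disk.turn 0) : ℂ)‖ = 1
      rw [h.petal_base hc, Disk.norm_turn]
    · intro z hz
      obtain ⟨x, hx, hx' | ⟨w, rfl, hw | ⟨k, y, hy, rfl⟩⟩⟩ := hcurve z hz
      · exact Or.inr ⟨x, Or.inl hx', hx⟩
      · exact Or.inr ⟨_, Or.inr ⟨w, Or.inl hw, rfl⟩, hx⟩
      · by_cases hk : k = j
        · subst hk; exact Or.inl ⟨y, hy, hx⟩
        · exact Or.inr ⟨_, Or.inr ⟨_, Or.inr (mem_iUnion.2 ⟨⟨k, hk⟩, y, mem_univ _, rfl⟩),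
            rfl⟩, hx⟩
  obtain ⟨x, hx, hx' | ⟨w, rfl, hw | ⟨k, y, hy, rfl⟩⟩⟩ := hcurve z hz
  · exact ⟨x, hx, Or.inl hx'⟩
  · exact ⟨_, hx, Or.inr ⟨w, rfl, hw⟩⟩
  obtain ⟨x', h1 | ⟨w', h1 | h1, rfl⟩, hx'⟩ := hexcl k z hz
  · exact ⟨x', hx', Or.inl h1⟩
  · exact ⟨_, hx', Or.inr ⟨w', rfl, h1⟩⟩
  -- The curve point lies on petal `k` and, in another description, on a different petal. Petals are
  -- disjoint, so the two descriptions are antipodal points of the unit circle.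
  rcases (h₀.eq_iff _ _).1 (hx.symm.trans hx') with h2 | ⟨h2, -⟩
  · rw [← hinj h2] at h1
    exact absurd h1 (hmem_other k y)
  · exact ⟨_, hx, Or.inl h2⟩

end IsPetalDecomposition

/-! ### Disk models of glued polygons -/

/-- Two points of the disk are equal or opposite boundary points. -/
def Disk.Antipodal (z w : Disk) : Prop := z = w ∨ ‖(z : ℂ)‖ = 1 ∧ (w : ℂ) = -(z : ℂ)

theorem Disk.antipodal_equivalence : Equivalence Disk.Antipodal where
  refl _ := Or.inl rfl
  symm := by
    rintro z w (rfl | ⟨h1, h2⟩)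
    · exact Or.inl rfl
    · exact Or.inr ⟨by rw [h2, norm_neg, h1], by rw [h2, neg_neg]⟩
  trans := by
    rintro z w v (rfl | ⟨h1, h2⟩) (rfl | ⟨h3, h4⟩)
    · exact Or.inl rfl
    · exact Or.inr ⟨h3, h4⟩
    · exact Or.inr ⟨h1, h2⟩
    · exact Or.inl (Subtype.ext (by rw [h4, h2, neg_neg]))

theorem Scheme.norm_sidePoint (K : Scheme) (i : Fin 4) (k : Fin (K i).length) (t : I) :
    ‖((K.sidePoint i k t).2 : ℂ)‖ = 1 := Disk.norm_turn _

/-- A description of the polygons glued along `E` as a disk such that gluing the remaining edges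
amounts to gluing the opposite boundary points. -/
structure IsModel (K : Scheme) (E : Set Edge) (Ψ : Polygons → Disk) : Prop where
  continuous : Continuous Ψ
  surjective : Function.Surjective Ψ
  mk_eq : ∀ x y, Ψ x = Ψ y → Scheme.Glued.mk K E x = Scheme.Glued.mk K E y
  eq_of_edgeGlue : ∀ x y, K.EdgeGlue E x y → Ψ x = Ψ y
  antipodal_of_edgeGlue : ∀ x y, K.EdgeGlue univ x y → Disk.Antipodal (Ψ x) (Ψ y)
  exists_edgeGlue : ∀ z : Disk, ‖(z : ℂ)‖ = 1 →
    ∃ x y, Ψ x = z ∧ (Ψ y : ℂ) = -(z : ℂ) ∧ K.EdgeGlue univ x y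

/-- It suffices to parametrize the image of every edge. -/
theorem IsModel.of_sides {K : Scheme} {E : Set Edge} {Ψ : Polygons → Disk}
    (hcont : Continuous Ψ) (hsurj : Function.Surjective Ψ)
    (hmk : ∀ x y, Ψ x = Ψ y → Scheme.Glued.mk K E x = Scheme.Glued.mk K E y)
    (η : Edge → I → Disk)
    (hE : ∀ i k t, K.edge i k ∈ E → Ψ (K.sidePoint i k t) = η (K.edge i k) t)
    (hη : ∀ i k t, K.edge i k ∉ E → Disk.Antipodal (Ψ (K.sidePoint i k t)) (η (K.edge i k) t))
    (hb : ∀ z : Disk, ‖(z : ℂ)‖ = 1 → ∃ x y, Ψ x = z ∧ (Ψ y : ℂ) = -(z : ℂ) ∧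
      K.EdgeGlue univ x y) : IsModel K E Ψ where
  continuous := hcont
  surjective := hsurj
  mk_eq := hmk
  eq_of_edgeGlue := by
    rintro x y ⟨i, k, j, l, t, h, hk, rfl, rfl⟩
    rw [hE i k t hk, hE j l t (h ▸ hk), h]
  antipodal_of_edgeGlue := by
    rintro x y ⟨i, k, j, l, t, h, -, rfl, rfl⟩
    have key : ∀ i k t, Disk.Antipodal (Ψ (K.sidePoint i k t)) (η (K.edge i k) t) := by
      intro i k t
      by_cases hk : K.edge i k ∈ E
      · exact Or.inl (hE i k t hk)
      · exact hη i k t hk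
    have h2 := key j l t
    rw [← h] at h2
    exact Disk.antipodal_equivalence.trans (key i k t) (Disk.antipodal_equivalence.symm h2)
  exists_edgeGlue := hb

namespace IsModel

variable {K : Scheme} {E : Set Edge} {Ψ : Polygons → Disk}

/-- A continuous bijection from a compact space to a Hausdorff space. -/
theorem exists_homeomorph (h : IsModel K E Ψ) :
    ∃ φ : Disk ≃ₜ K.Glued E, ∀ x, φ (Ψ x) = Scheme.Glued.mk K E x := by
  let ψ : K.Glued E → Disk := Quot.lift Ψ h.eq_of_edgeGlue
  have hψ : Continuous ψ := continuous_quot_lift _ h.continuous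
  have hbij : Function.Bijective ψ := by
    constructor
    · rintro ⟨x⟩ ⟨y⟩ hxy
      exact h.mk_eq x y hxy
    · intro z
      obtain ⟨x, rfl⟩ := h.surjective z
      exact ⟨Scheme.Glued.mk K E x, rfl⟩
  have : CompactSpace (K.Glued E) := inferInstanceAs (CompactSpace (Quot (K.EdgeGlue E)))
  let e : K.Glued E ≃ₜ Disk :=
    hψ.homeoOfEquivCompactToT2 (f := Equiv.ofBijective ψ hbij)
  exact ⟨e.symm, fun x => e.symm_apply_eq.2 rfl⟩

variable {P S : Type*} [TopologicalSpace P] [TopologicalSpace S] {f : P → S}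

theorem isRepresentation (h : IsModel K E Ψ) (c : CellStructure K f) (φ : Disk ≃ₜ K.Glued E)
    (hφ : ∀ x, φ (Ψ x) = Scheme.Glued.mk K E x) : c.IsRepresentation (c.proj E ∘ φ) where
  isQuotientMap := by
    refine IsQuotientMap.comp (c.domain.isQuotientMap.comp ?_) φ.isQuotientMap
    have h1 : IsQuotientMap (Scheme.Glued.mk K E) := isQuotientMap_quot_mk
    have h2 : IsQuotientMap (K.glueRest E ∘ Scheme.Glued.mk K E) :=
      isQuotientMap_quot_mk (r := K.EdgeGlue univ)
    exact IsQuotientMap.of_comp h1.continuous (h1.continuous_iff.2 h2.continuous) h2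
  eq_iff z w := by
    have hrest : c.proj E (φ z) = c.proj E (φ w) ↔
        K.glueRest E (φ z) = K.glueRest E (φ w) := c.domain.injective.eq_iff
    rw [Function.comp_apply, Function.comp_apply, hrest]
    constructor
    · obtain ⟨x, rfl⟩ := h.surjective z
      obtain ⟨y, rfl⟩ := h.surjective w
      rw [hφ, hφ]
      intro hxy
      -- The full gluing maps to the disk modulo antipodes, which separates the points in question.
      exact Quotient.exact (congrArg (Quot.lift
        (fun x => Quotient.mk ⟨_, Disk.antipodal_equivalence⟩ (Ψ x))
        fun x y hxy => Quotient.sound (h.antipodal_of_edgeGlue x y hxy)) hxy)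
    · rintro (rfl | ⟨h1, h2⟩)
      · rfl
      · obtain ⟨x, y, rfl, hy, hxy⟩ := h.exists_edgeGlue z h1
        obtain rfl : w = Ψ y := Subtype.ext (h2.trans hy.symm)
        rw [hφ, hφ]
        exact Quot.sound hxy
  boundary z hz := by
    obtain ⟨x, y, rfl, -, i, k, j, l, t, -, -, rfl, -⟩ := h.exists_edgeGlue z hz
    rw [Function.comp_apply, hφ]
    exact ⟨_, ⟨_, K.norm_sidePoint i k t, rfl⟩, (c.comm (Scheme.Glued.mk K univ _)).symm⟩

theorem exists_boundary_eq (c : CellStructure K f) (φ : Disk ≃ₜ K.Glued E)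
    (hφ : ∀ x, φ (Ψ x) = Scheme.Glued.mk K E x) {q : Disk → P} (hq : c.IsRepresentation q)
    (z : Disk) (hz : ‖(z : ℂ)‖ = 1) :
    ∃ x : Polygons, ‖(x.2 : ℂ)‖ = 1 ∧ q z = (c.proj E ∘ φ) (Ψ x) := by
  obtain ⟨d, hd⟩ := c.domain.surjective (q z)
  obtain ⟨x, rfl⟩ : ∃ x, Scheme.Glued.mk K univ x = d := Quot.exists_rep d
  refine ⟨x, ?_, by rw [Function.comp_apply, hφ]; exact hd.symm⟩
  have h1 := hq.boundary z hz
  rw [← hd, c.comm] at h1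
  obtain ⟨_, ⟨x', hx', rfl⟩, h2⟩ := h1
  -- `LoopGlue` relates only boundary points of polygons. Being a boundary point is therefore a
  -- well-defined predicate on the surface, and every representative of a point of the 1-skeleton
  -- satisfies it.
  have h3 := congrArg (Quot.lift (fun x : Polygons => ‖(x.2 : ℂ)‖ = 1) (by
    rintro x y ⟨i, k, j, l, t, -, rfl, rfl⟩
    simp only [K.norm_sidePoint])) (c.isEmbedding_image.injective h2)
  exact h3.mp hx'

/-- The representation given by a planar model is unique if every curve in the 1-skeleton that
does not separate the projective plane lies in the image of the boundary of the model. -/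
theorem exists_homeomorph_eq (h : IsModel K E Ψ) (c : CellStructure K f)
    (φ : Disk ≃ₜ K.Glued E) (hφ : ∀ x, φ (Ψ x) = Scheme.Glued.mk K E x)
    (hcurve : ∀ q₀ q : Disk → P, IsAntipodalQuotient q₀ → IsAntipodalQuotient q →
      (∀ z : Disk, ‖(z : ℂ)‖ = 1 → ∃ x : Polygons, ‖(x.2 : ℂ)‖ = 1 ∧ q z = q₀ (Ψ x)) →
      ∀ z : Disk, ‖(z : ℂ)‖ = 1 → ∃ w : Disk, ‖(w : ℂ)‖ = 1 ∧ q z = q₀ w)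
    (q : Disk → P) (hq : c.IsRepresentation q) :
    ∃ l : Disk ≃ₜ Disk, q = (c.proj E ∘ φ) ∘ l := by
  have h₀ := h.isRepresentation c φ hφ
  have h₀' : IsAntipodalQuotient (c.proj E ∘ φ) := ⟨h₀.isQuotientMap, h₀.eq_iff⟩
  have hq' : IsAntipodalQuotient q := ⟨hq.isQuotientMap, hq.eq_iff⟩
  exact hq'.exists_homeomorph h₀' (hcurve _ _ h₀' hq' (exists_boundary_eq c φ hφ hq))

end IsModel

/-- Maps from the core and the petals that agree on the glued arcs define a map from the disk. -/
theorem IsPetalDecomposition.exists_desc {J : Type*} {c : ℝ → ℝ} {a b : J → ℝ} {n : Disk → Disk}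
    {p : J → Disk → Disk} (h : IsPetalDecomposition c a b n p) {T : Type*} (μ : Disk → T)
    (ν : J → Disk → T)
    (hμν : ∀ (j : J) (t : I), μ (Disk.turn (a j + (b j - a j) * t)) = ν j (Disk.turn t)) :
    ∃ G : Disk → T, (∀ x, G (n x) = μ x) ∧ ∀ j y, G (p j y) = ν j y := by
  classical
  have hcp : ∀ x j y, n x = p j y → μ x = ν j y := by
    intro x j y hxy
    obtain ⟨t, rfl, rfl⟩ := h.core_eq_petal x j y hxy
    exact hμν j t
  have hend : ∀ j x, x = Disk.turn (a j) ∨ x = Disk.turn (b j) → μ x = ν j (Disk.turn 0) := by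
    rintro j x (rfl | rfl)
    · simpa using hμν j 0
    · simpa using hμν j 1
  have hcc : ∀ x x', n x = n x' → μ x = μ x' := by
    intro x x' hxx
    rcases h.core_eq_core x x' hxx with rfl | ⟨j, h1, h2⟩
    · rfl
    · rw [hend j x h1, hend j x' h2]
  have hex : ∀ z, ∃ v, (∀ x, n x = z → μ x = v) ∧ ∀ j y, p j y = z → ν j y = v := by
    intro z
    rcases h.surjective z with ⟨x, rfl⟩ | ⟨j, y, rfl⟩
    · exact ⟨μ x, fun x' h' => hcc x' x h', fun j y h' => (hcp x j y h'.symm).symm⟩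
    · refine ⟨ν j y, fun x h' => hcp x j y h', fun j' y' h' => ?_⟩
      obtain ⟨rfl, rfl⟩ := h.petal_eq_petal _ _ _ _ h'
      rfl
  choose G hG using hex
  exact ⟨G, fun x => ((hG _).1 x rfl).symm, fun j y => ((hG _).2 j y rfl).symm⟩

/-! ### Coordinates along the sides of a polygon -/

theorem Scheme.sidePoint_of_true {K : Scheme} {i : Fin 4} {k : Fin (K i).length} (k' m : ℕ)
    (t : I) (h : ((K i).get k).2 = true) (hk : (k : ℕ) = k') (hm : (K i).length = m) :
    K.sidePoint i k t = ⟨i, Disk.turn ((k' + t) / m)⟩ := by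
  rw [Scheme.sidePoint, h, hk, hm]
  rfl

theorem Scheme.sidePoint_of_false {K : Scheme} {i : Fin 4} {k : Fin (K i).length} (k' m : ℕ)
    (t : I) (h : ((K i).get k).2 = false) (hk : (k : ℕ) = k') (hm : (K i).length = m) :
    K.sidePoint i k t = ⟨i, Disk.turn ((k' + (1 - t)) / m)⟩ := by
  rw [Scheme.sidePoint, h, hk, hm]
  rfl

theorem exists_side {N : ℕ} (hN : 0 < N) (s : I) :
    ∃ (k : Fin N) (t : I), (s : ℝ) = ((k : ℕ) + (t : ℝ)) / N := by
  have hN' : (0 : ℝ) < N := by exact_mod_cast hN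
  have s0 := s.2.1
  rcases s.2.2.lt_or_eq with h | h
  · have hfl := Nat.floor_le (mul_nonneg hN'.le s0)
    have hlt := Nat.lt_floor_add_one ((N : ℝ) * s)
    refine ⟨⟨⌊(N : ℝ) * s⌋₊, ?_⟩, ⟨N * s - ⌊(N : ℝ) * s⌋₊, by linarith, by linarith⟩, ?_⟩
    · rw [Nat.floor_lt (mul_nonneg hN'.le s0)]
      exact mul_lt_of_lt_one_right hN' h
    · rw [eq_div_iff hN'.ne']
      push_cast; ring
  -- At `s = 1` the floor would give a side `N` that does not exist; the end of the last side is
  -- used.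
  · refine ⟨⟨N - 1, by omega⟩, 1, ?_⟩
    rw [h, eq_div_iff hN'.ne', one_mul]
    simp [Nat.cast_sub (show 1 ≤ N from hN)]

/-- The arcs of the sides `1`, `4`, `7`, … of a polygon with `N` sides. -/
noncomputable def arcStart (N m : ℕ) (j : Fin m) : ℝ := (3 * ((j : ℕ) : ℝ) + 1) / N

/-- The end points of the arcs. -/
noncomputable def arcEnd (N m : ℕ) (j : Fin m) : ℝ := (3 * ((j : ℕ) : ℝ) + 2) / N

theorem arcStart_add_mul {N m : ℕ} (j : Fin m) (t : ℝ) :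
    arcStart N m j + (arcEnd N m j - arcStart N m j) * t = (3 * ((j : ℕ) : ℝ) + 1 + t) / N := by
  rw [arcStart, arcEnd]; ring

/-- Strict inequalities between integer endpoints leave only `k` congruent to `3j + 1` modulo `N`.
As `3m ≤ N + 1`, the arcs end by `1`, so no wrap-around occurs. -/
theorem notMem_openArcs {N m : ℕ} (hN : 0 < N) (k : ℕ) (hk : k < N)
    (hk3 : ∀ j < m, k ≠ 3 * j + 1) (hm : 3 * m ≤ N + 1) (t : I) :
    ((k : ℝ) + t) / N ∉ openArcs (arcStart N m) (arcEnd N m) := by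
  rintro ⟨j, l, h1, h2⟩
  have hN' : (0 : ℝ) < N := by exact_mod_cast hN
  rw [arcStart, div_add' _ _ _ hN'.ne', div_lt_div_iff_of_pos_right hN'] at h1
  rw [arcEnd, div_add' _ _ _ hN'.ne', div_lt_div_iff_of_pos_right hN'] at h2
  have t0 := t.2.1
  have t1 := t.2.2
  have e1 : (3 * (j : ℕ) + 1 + l * N : ℤ) < k + 1 := by
    have : (((3 * (j : ℕ) + 1 + l * N : ℤ)) : ℝ) < ((k + 1 : ℤ) : ℝ) := by push_cast; linarith
    exact_mod_cast this
  have e2 : (k : ℤ) < 3 * (j : ℕ) + 2 + l * N := by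
    have : ((k : ℤ) : ℝ) < ((3 * (j : ℕ) + 2 + l * N : ℤ) : ℝ) := by push_cast; linarith
    exact_mod_cast this
  have hj := j.2
  have e3 : (k : ℤ) = 3 * (j : ℕ) + 1 + l * N := by omega
  have hl : l = 0 := by
    have f1 : l * (N : ℤ) < 1 * N := by omega
    have f2 : (-1) * (N : ℤ) < l * N := by omega
    have f3 : (0 : ℤ) < N := by exact_mod_cast hN
    have := lt_of_mul_lt_mul_right f1 f3.le
    have := lt_of_mul_lt_mul_right f2 f3.le
    omega
  rw [hl] at e3
  exact hk3 j hj (by omega)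

/-- The collapse of the sides `1`, `4`, `7`, … for a function of the side coordinate. -/
theorem isCollapse_arcs {N m : ℕ} (hN : 0 < N) (hm : 3 * m ≤ N + 1) {c : ℝ → ℝ}
    (hcont : Continuous c) (hmono : Monotone c) (h0 : c 0 = 0) (h1 : c 1 = 1)
    (hconst : ∀ j, c (arcStart N m j) = c (arcEnd N m j))
    (heq : ∀ x x', 0 ≤ x → x < x' → x' ≤ 1 → c x = c x' →
      ∃ j : Fin m, 3 * ((j : ℕ) : ℝ) + 1 ≤ N * x ∧ N * x' ≤ 3 * ((j : ℕ) : ℝ) + 2) :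
    IsCollapse (periodize c) (arcStart N m) (arcEnd N m) := by
  have hN' : (0 : ℝ) < N := by exact_mod_cast hN
  have hpos : ∀ j : Fin m, 0 < arcStart N m j := fun j => by unfold arcStart; positivity
  refine isCollapse_periodize hcont hmono h0 h1 (fun j => (hpos j).le) (fun j => ?_) (fun j => ?_)
    hconst ?_ ?_ fun j k => Or.inl (hpos j)
  · rw [arcEnd, div_le_one hN']
    have : 3 * (j : ℕ) + 2 ≤ N := by have := j.2; omega
    exact_mod_cast this
  · exact div_lt_div_of_pos_right (by linarith) hN'
  · intro x x' hx hxx hx' h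
    obtain ⟨j, hj, hj'⟩ := heq x x' hx hxx hx' h
    refine ⟨j, ?_, ?_⟩
    · rw [arcStart, div_le_iff₀ hN']; linarith
    · rw [arcEnd, le_div_iff₀ hN']; linarith
  · rintro x j k ⟨e1, e2⟩ ⟨e3, e4⟩
    rw [arcStart, div_le_iff₀ hN'] at e1 e3
    rw [arcEnd, le_div_iff₀ hN'] at e2 e4
    have f1 : ((3 * (j : ℕ) + 1 : ℕ) : ℝ) ≤ ((3 * (k : ℕ) + 2 : ℕ) : ℝ) := by push_cast; linarith
    have f2 : ((3 * (k : ℕ) + 1 : ℕ) : ℝ) ≤ ((3 * (j : ℕ) + 2 : ℕ) : ℝ) := by push_cast; linarith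
    have f1' := Nat.cast_le.1 f1
    have f2' := Nat.cast_le.1 f2
    exact Fin.ext (by omega)

/-- Seen from a point of side `k`, the term for side `k'` measures how much of side `k'` has been
passed. -/
theorem clamp_side (k k' : ℕ) (t : I) :
    clamp (k + t - k') = if k' < k then 1 else if k' = k then (t : ℝ) else 0 := by
  have t0 := t.2.1
  have t1 := t.2.2
  split_ifs with h1 h2
  · have : (k' : ℝ) + 1 ≤ k := by exact_mod_cast h1
    exact clamp_of_one_le (by linarith)
  · subst h2
    rw [add_sub_cancel_left, clamp_of_mem t0 t1]
  · have : (k : ℝ) + 1 ≤ k' := by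
      have : k + 1 ≤ k' := by omega
      exact_mod_cast this
    exact clamp_of_nonpos (by linarith)

/-! ### The planar model of the Boy's surface -/

/-- The collapse of the glued sides of the nonagon. -/
noncomputable def boyCollapse (x : ℝ) : ℝ :=
  (clamp (9 * x) + clamp (9 * x - 2) + clamp (9 * x - 3) + clamp (9 * x - 5) +
    clamp (9 * x - 6) + clamp (9 * x - 8)) / 6

/-- Each free side contributes one monotone term. If the sum agrees at `x` and `y`, every term does,
so the interval overlaps no free side and lies in one of the sides `1`, `4`, `7`. -/
theorem isCollapse_boy :
    IsCollapse (periodize boyCollapse) (arcStart 9 3) (arcEnd 9 3) := by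
  have hcl := continuous_clamp
  have hmono : ∀ k x y : ℝ, x ≤ y → clamp (9 * x - k) ≤ clamp (9 * y - k) :=
    fun k x y h => monotone_clamp (by linarith)
  have hmono0 : ∀ x y : ℝ, x ≤ y → clamp (9 * x) ≤ clamp (9 * y) :=
    fun x y h => monotone_clamp (by linarith)
  refine isCollapse_arcs (by norm_num) (by norm_num) (by unfold boyCollapse; fun_prop) ?_ ?_ ?_
    ?_ ?_
  · intro x y h
    unfold boyCollapse
    linarith [hmono0 x y h, hmono 2 x y h, hmono 3 x y h, hmono 5 x y h, hmono 6 x y h,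
      hmono 8 x y h]
  · unfold boyCollapse
    simp (disch := norm_num) only [clamp_of_nonpos]
    norm_num
  · unfold boyCollapse
    simp (disch := norm_num) only [clamp_of_one_le]
    norm_num
  · intro j
    unfold boyCollapse arcStart arcEnd
    fin_cases j <;> norm_num <;>
      simp (disch := norm_num) only [clamp_of_one_le, clamp_of_nonpos]
  · intro x y hx hxy hy h
    unfold boyCollapse at h
    have e0 := hmono0 x y hxy.le
    have e2 := hmono 2 x y hxy.le
    have e3 := hmono 3 x y hxy.le
    have e5 := hmono 5 x y hxy.le
    have e6 := hmono 6 x y hxy.le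
    have e8 := hmono 8 x y hxy.le
    have key : ∀ k : ℝ, clamp (9 * x - k) = clamp (9 * y - k) → 9 * y ≤ k ∨ k + 1 ≤ 9 * x := by
      intro k hk
      rcases of_clamp_eq (by linarith) hk with h' | h'
      · left; linarith
      · right; linarith
    have key0 : 9 * y ≤ 0 ∨ 1 ≤ 9 * x := of_clamp_eq (by linarith) (by linarith)
    have f0 : 1 ≤ 9 * x := key0.resolve_left (by linarith)
    rcases key 2 (by linarith) with g | f2
    · exact ⟨0, by norm_num; linarith, by norm_num; linarith⟩
    have f3 := (key 3 (by linarith)).resolve_left (by linarith)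
    rcases key 5 (by linarith) with g | f5
    · exact ⟨1, by norm_num; linarith, by norm_num; linarith⟩
    have f6 := (key 6 (by linarith)).resolve_left (by linarith)
    rcases key 8 (by linarith) with g | f8
    · exact ⟨2, by norm_num; linarith, by norm_num; linarith⟩
    linarith

theorem boyCollapse_side (t : I) (k : ℕ) (y : ℝ)
    (h : (k, y) ∈ [(0, 0), (2, 1), (3, 2), (5, 3), (6, 4), (8, (5 : ℝ))]) :
    periodize boyCollapse ((k + t) / 9) = (y + t) / 6 := by
  have t0 := t.2.1
  have t1 := t.2.2
  have h0 : boyCollapse 0 = 0 := by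
    unfold boyCollapse
    simp (disch := norm_num) only [clamp_of_nonpos]
    norm_num
  have h1 : boyCollapse 1 = 1 := by
    unfold boyCollapse
    simp (disch := norm_num) only [clamp_of_one_le]
    norm_num
  have hk : (k : ℝ) ≤ 8 := by
    simp only [List.mem_cons, Prod.mk.injEq, List.not_mem_nil, or_false] at h
    have : k ≤ 8 := by omega
    exact_mod_cast this
  have e := periodize_add_int h0 h1 (x := (k + t) / 9) (by positivity) (by linarith) 0
  simp only [Int.cast_zero, add_zero] at e
  rw [e, boyCollapse]
  simp only [mul_div_cancel₀ _ (show (9 : ℝ) ≠ 0 by norm_num)]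
  have e0 := clamp_side k 0 t
  have e2 := clamp_side k 2 t
  have e3 := clamp_side k 3 t
  have e5 := clamp_side k 5 t
  have e6 := clamp_side k 6 t
  have e8 := clamp_side k 8 t
  push_cast at e0 e2 e3 e5 e6 e8
  rw [sub_zero] at e0
  rw [e0, e2, e3, e5, e6, e8]
  simp only [List.mem_cons, Prod.mk.injEq, List.not_mem_nil, or_false] at h
  rcases h with ⟨rfl, rfl⟩ | ⟨rfl, rfl⟩ | ⟨rfl, rfl⟩ | ⟨rfl, rfl⟩ | ⟨rfl, rfl⟩ | ⟨rfl, rfl⟩ <;>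
    norm_num

/-- The map from the polygons of the Boy's surface to the disk. -/
noncomputable def boyModel (n : Disk → Disk) (p : Fin 3 → Disk → Disk) (x : Polygons) : Disk :=
  match x with
  | ⟨0, z⟩ => p 2 z.conj
  | ⟨1, z⟩ => p 1 z.conj
  | ⟨2, z⟩ => p 0 z.conj
  | ⟨3, z⟩ => n z

/-- The images of the edges of the Boy's surface. -/
noncomputable def boyEdge (p : Fin 3 → Disk → Disk) (e : Edge) (t : I) : Disk :=
  match e with
  | .A => Disk.turn (t / 6)
  | .B => Disk.turn ((1 + t) / 6)
  | .C => Disk.turn ((2 + t) / 6)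
  | .A' => p 2 (Disk.turn (-t))
  | .B' => p 1 (Disk.turn (-t))
  | .C' => p 0 (Disk.turn (-t))

section

variable {n : Disk → Disk} {p : Fin 3 → Disk → Disk}

/-- Free sides avoid the open arcs, so the core map is the collapse there. All of them are traversed
along their edges. -/
theorem boyModel_side (h : IsPetalDecomposition (periodize boyCollapse) (arcStart 9 3)
    (arcEnd 9 3) n p) (k : Fin 6) (t : I) :
    boyModel n p (boy.sidePoint 3 (boySide k) t) = Disk.turn (((k : ℕ) + (t : ℝ)) / 6) := by
  have key : ∀ (l : ℕ) (y : ℝ),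
      (l, y) ∈ [(0, 0), (2, 1), (3, 2), (5, 3), (6, 4), (8, (5 : ℝ))] →
      n (Disk.turn (((l : ℝ) + t) / 9)) = Disk.turn ((y + t) / 6) := by
    intro l y hl
    rw [← boyCollapse_side t l y hl, h.core_turn]
    simp only [List.mem_cons, Prod.mk.injEq, List.not_mem_nil, or_false] at hl
    exact_mod_cast notMem_openArcs (N := 9) (m := 3) (by norm_num) l (by omega)
      (fun j hj => by omega) (by norm_num) t
  fin_cases k
  · rw [Scheme.sidePoint_of_true 0 9 t rfl rfl rfl]
    simpa [boyModel] using key 0 0 (by simp)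
  · rw [Scheme.sidePoint_of_true 2 9 t rfl rfl rfl]
    simpa [boyModel] using key 2 1 (by simp)
  · rw [Scheme.sidePoint_of_true 3 9 t rfl rfl rfl]
    simpa [boyModel] using key 3 2 (by simp)
  · rw [Scheme.sidePoint_of_true 5 9 t rfl rfl rfl]
    simpa [boyModel] using key 5 3 (by simp)
  · rw [Scheme.sidePoint_of_true 6 9 t rfl rfl rfl]
    simpa [boyModel] using key 6 4 (by simp)
  · rw [Scheme.sidePoint_of_true 8 9 t rfl rfl rfl]
    simpa [boyModel] using key 8 5 (by simp)

theorem arcStart_add_mul_side {N m : ℕ} (j : Fin m) (t : I) (k : ℕ) (hk : k = 3 * (j : ℕ) + 1) :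
    ((k : ℝ) + t) / N = arcStart N m j + (arcEnd N m j - arcStart N m j) * t := by
  rw [arcStart_add_mul, hk]
  push_cast; ring

theorem Disk.turn_one_sub (t : ℝ) : Disk.turn (1 - t) = Disk.turn (-t) := by
  rw [← Disk.turn_add_one (-t)]
  congr 1
  ring

theorem Disk.antipodal_turn {s s' : ℝ} (h : s = s' + 1 / 2) :
    Disk.Antipodal (Disk.turn s) (Disk.turn s') := by
  subst h
  exact Or.inr ⟨Disk.norm_turn _, by rw [Disk.coe_turn_add_half, neg_neg]⟩

/-- The nonagon reads `A'`, `B'`, `C'` backwards while the monogons read them forwards, so the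
monogons enter reflected. The sides `1`, `4`, `7` carry `C'`, `B'`, `A'`, which explains why monogon
`i` is petal `2 - i`. -/
theorem isModel_boy (h : IsPetalDecomposition (periodize boyCollapse) (arcStart 9 3)
    (arcEnd 9 3) n p) : IsModel boy boyGlued (boyModel n p) := by
  have hside := boyModel_side h
  have hglued : ∀ (j : Fin 3) (t : I) (k : ℕ), k = 3 * (j : ℕ) + 1 →
      n (Disk.turn (((k : ℝ) + (1 - t)) / 9)) = p j (Disk.turn (-t)) := by
    intro j t k hk
    have h1 := h.core_arc j (unitInterval.symm t)
    rw [← arcStart_add_mul_side j _ k hk] at h1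
    simp only [unitInterval.coe_symm_eq, Disk.turn_one_sub] at h1
    exact_mod_cast h1
  refine IsModel.of_sides ?_ ?_ ?_ (boyEdge p) ?_ ?_ ?_
  · refine continuous_sigma fun i => ?_
    fin_cases i
    · exact (h.continuous_petal 2).comp Disk.continuous_conj
    · exact (h.continuous_petal 1).comp Disk.continuous_conj
    · exact (h.continuous_petal 0).comp Disk.continuous_conj
    · exact h.continuous_core
  · intro z
    rcases h.surjective z with ⟨x, rfl⟩ | ⟨j, y, rfl⟩
    · exact ⟨⟨3, x⟩, rfl⟩
    · fin_cases j
      · exact ⟨⟨2, y.conj⟩, by simp [boyModel]⟩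
      · exact ⟨⟨1, y.conj⟩, by simp [boyModel]⟩
      · exact ⟨⟨0, y.conj⟩, by simp [boyModel]⟩
  · let mk := Scheme.Glued.mk boy boyGlued
    -- The class map factors through the disk as `G`, so points with the same image are already
    -- glued. No continuity of `G` is needed.
    obtain ⟨G, hG1, hG2⟩ := h.exists_desc (fun z => mk ⟨3, z⟩)
      (fun j z => mk ⟨(![2, 1, 0] : Fin 3 → Fin 4) j, z.conj⟩) (by
        intro j t
        rw [Disk.conj_turn, ← Disk.turn_one_sub]
        have e : Disk.turn (1 - t) = Disk.turn (((0 : ℕ) + (unitInterval.symm t : ℝ)) / (1 : ℕ)) := by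
          simp
        have e' : ∀ k : ℕ, k = 3 * (j : ℕ) + 1 →
            Disk.turn (arcStart 9 3 j + (arcEnd 9 3 j - arcStart 9 3 j) * t) =
            Disk.turn ((k + (1 - (unitInterval.symm t : ℝ))) / (9 : ℕ)) := by
          intro k hk
          rw [← arcStart_add_mul_side j t k hk]
          simp
        rw [e]
        fin_cases j
        · rw [e' 1 rfl, ← Scheme.sidePoint_of_false (K := boy) (i := 3) (k := (1 : Fin 9)) 1 9
            (unitInterval.symm t) rfl rfl rfl]
          refine Quot.sound ⟨3, (1 : Fin 9), 2, (0 : Fin 1), unitInterval.symm t, rfl, ?_, rfl, ?_⟩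
          · simp [Scheme.edge, boy]
          · exact (Scheme.sidePoint_of_true 0 1 _ rfl rfl rfl).symm
        · rw [e' 4 rfl, ← Scheme.sidePoint_of_false (K := boy) (i := 3) (k := (4 : Fin 9)) 4 9
            (unitInterval.symm t) rfl rfl rfl]
          refine Quot.sound ⟨3, (4 : Fin 9), 1, (0 : Fin 1), unitInterval.symm t, rfl, ?_, rfl, ?_⟩
          · simp [Scheme.edge, boy]
          · exact (Scheme.sidePoint_of_true 0 1 _ rfl rfl rfl).symm
        · rw [e' 7 rfl, ← Scheme.sidePoint_of_false (K := boy) (i := 3) (k := (7 : Fin 9)) 7 9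
            (unitInterval.symm t) rfl rfl rfl]
          refine Quot.sound ⟨3, (7 : Fin 9), 0, (0 : Fin 1), unitInterval.symm t, rfl, ?_, rfl, ?_⟩
          · simp [Scheme.edge, boy]
          · exact (Scheme.sidePoint_of_true 0 1 _ rfl rfl rfl).symm)
    have hG : ∀ x, G (boyModel n p x) = mk x := by
      rintro ⟨i, z⟩
      fin_cases i
      · exact (hG2 2 _).trans (by simp)
      · exact (hG2 1 _).trans (by simp)
      · exact (hG2 0 _).trans (by simp)
      · exact hG1 z
    intro x y hxy
    exact (hG x).symm.trans ((congrArg G hxy).trans (hG y))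
  · intro i k t hk
    fin_cases i
    · obtain ⟨k, hk'⟩ := k
      obtain rfl : k = 0 := Nat.lt_one_iff.1 hk'
      rw [Scheme.sidePoint_of_true 0 1 t rfl rfl rfl]
      simp [boyModel, boyEdge, Scheme.edge, boy]
    · obtain ⟨k, hk'⟩ := k
      obtain rfl : k = 0 := Nat.lt_one_iff.1 hk'
      rw [Scheme.sidePoint_of_true 0 1 t rfl rfl rfl]
      simp [boyModel, boyEdge, Scheme.edge, boy]
    · obtain ⟨k, hk'⟩ := k
      obtain rfl : k = 0 := Nat.lt_one_iff.1 hk'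
      rw [Scheme.sidePoint_of_true 0 1 t rfl rfl rfl]
      simp [boyModel, boyEdge, Scheme.edge, boy]
    · change Fin 9 at k
      fin_cases k
      · exact absurd hk (by simp [Scheme.edge, boy])
      · exact (congrArg _ (Scheme.sidePoint_of_false 1 9 t rfl rfl rfl)).trans (hglued 0 t 1 rfl)
      · exact absurd hk (by simp [Scheme.edge, boy])
      · exact absurd hk (by simp [Scheme.edge, boy])
      · exact (congrArg _ (Scheme.sidePoint_of_false 4 9 t rfl rfl rfl)).trans (hglued 1 t 4 rfl)
      · exact absurd hk (by simp [Scheme.edge, boy])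
      · exact absurd hk (by simp [Scheme.edge, boy])
      · exact (congrArg _ (Scheme.sidePoint_of_false 7 9 t rfl rfl rfl)).trans (hglued 2 t 7 rfl)
      · exact absurd hk (by simp [Scheme.edge, boy])
  · intro i k t hk
    fin_cases i
    · obtain ⟨k, hk'⟩ := k
      obtain rfl : k = 0 := Nat.lt_one_iff.1 hk'
      exact absurd hk (by simp [Scheme.edge, boy])
    · obtain ⟨k, hk'⟩ := k
      obtain rfl : k = 0 := Nat.lt_one_iff.1 hk'
      exact absurd hk (by simp [Scheme.edge, boy])
    · obtain ⟨k, hk'⟩ := k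
      obtain rfl : k = 0 := Nat.lt_one_iff.1 hk'
      exact absurd hk (by simp [Scheme.edge, boy])
    · change Fin 9 at k
      fin_cases k
      · exact Or.inl ((hside 0 t).trans (by simp [boyEdge, Scheme.edge, boy]))
      · exact absurd hk (by simp [Scheme.edge, boy])
      · exact Or.inl ((hside 1 t).trans (by simp [boyEdge, Scheme.edge, boy]))
      · exact Or.inl ((hside 2 t).trans (by simp [boyEdge, Scheme.edge, boy]))
      · exact absurd hk (by simp [Scheme.edge, boy])
      · refine (hside 3 t).symm ▸ Disk.antipodal_turn ?_
        norm_num; ring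
      · refine (hside 4 t).symm ▸ Disk.antipodal_turn ?_
        norm_num; ring
      · exact absurd hk (by simp [Scheme.edge, boy])
      · refine (hside 5 t).symm ▸ Disk.antipodal_turn ?_
        norm_num; ring
  · intro z hz
    -- Sides `k` and `k + 3` of the hexagon carry the same edge in the same direction; `m` reduces
    -- the index modulo `6`.
    have hopp : ∀ (k l : Fin 6) (t : I) (s : ℝ) (m : ℤ), s = ((k : ℕ) + (t : ℝ)) / 6 →
        ((l : ℕ) : ℝ) = (k : ℕ) + 3 + 6 * m →
        boy.edge 3 (boySide k) = boy.edge 3 (boySide l) →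
        ∃ x y, boyModel n p x = Disk.turn s ∧ (boyModel n p y : ℂ) = -(Disk.turn s : ℂ) ∧
          boy.EdgeGlue univ x y := by
      rintro k l t s m rfl hl hkl
      refine ⟨_, _, hside k t, ?_, 3, boySide k, 3, boySide l, t, hkl, mem_univ _, rfl, rfl⟩
      rw [hside, ← Disk.coe_turn_add_half, ← Disk.turn_add_int (((k : ℕ) + (t : ℝ)) / 6 + 1 / 2) m, hl]
      congr 2
      ring
    obtain ⟨s, rfl⟩ := Disk.exists_turn_unit hz
    obtain ⟨k, t, hs⟩ := exists_side (N := 6) (by norm_num) s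
    replace hs : (s : ℝ) = ((k : ℕ) + (t : ℝ)) / 6 := by exact_mod_cast hs
    fin_cases k
    · exact hopp 0 3 t s 0 hs (by norm_num) rfl
    · exact hopp 1 4 t s 0 hs (by norm_num) rfl
    · exact hopp 2 5 t s 0 hs (by norm_num) rfl
    · exact hopp 3 0 t s (-1) hs (by norm_num) rfl
    · exact hopp 4 1 t s (-1) hs (by norm_num) rfl
    · exact hopp 5 2 t s (-1) hs (by norm_num) rfl

/-- In the Boy's surface, a curve in the 1-skeleton that does not separate the projective plane
avoids the loops that bound the monogons. -/
theorem boy_boundary_subset (h : IsPetalDecomposition (periodize boyCollapse) (arcStart 9 3)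
    (arcEnd 9 3) n p) {P : Type*} [TopologicalSpace P] {q₀ q : Disk → P}
    (h₀ : IsAntipodalQuotient q₀) (hq : IsAntipodalQuotient q)
    (hcurve : ∀ z : Disk, ‖(z : ℂ)‖ = 1 →
      ∃ x : Polygons, ‖(x.2 : ℂ)‖ = 1 ∧ q z = q₀ (boyModel n p x))
    (z : Disk) (hz : ‖(z : ℂ)‖ = 1) : ∃ w : Disk, ‖(w : ℂ)‖ = 1 ∧ q z = q₀ w := by
  -- The petals sit in the whole disk: the embedding is the identity and nothing lies outside it.
  obtain ⟨x, hx, hx' | ⟨_, rfl, hw⟩⟩ := h.boundary_subset isCollapse_boy h₀ hq (e := id)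
    (N := ∅) continuous_id Function.injective_id isClosed_empty (fun x => Or.inr ⟨x, rfl⟩)
    (fun y hy => hy.elim) (fun y hy => hy) (by
      intro z hz
      obtain ⟨⟨i, x⟩, hx, hx'⟩ := hcurve z hz
      refine ⟨_, hx', Or.inr ⟨_, rfl, ?_⟩⟩
      fin_cases i
      · exact Or.inr ⟨2, x.conj, by rw [Disk.norm_conj]; exact hx, rfl⟩
      · exact Or.inr ⟨1, x.conj, by rw [Disk.norm_conj]; exact hx, rfl⟩
      · exact Or.inr ⟨0, x.conj, by rw [Disk.norm_conj]; exact hx, rfl⟩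
      · exact h.core_boundary hx) z hz
  · exact ⟨x, hx', hx⟩
  · exact ⟨_, hw, hx⟩

end

/-! ### The planar model of the Girl's surface -/

/-- The collapse of the three consecutive glued sides of the first pentagon. -/
noncomputable def girlOuter (x : ℝ) : ℝ := (clamp (5 * x) + clamp (5 * x - 4)) / 2

/-- The collapse of the sides of the second pentagon that are glued to the monogons. -/
noncomputable def girlInner (x : ℝ) : ℝ :=
  (clamp (5 * x) + clamp (5 * x - 2) + clamp (5 * x - 3)) / 3

theorem girlOuter_zero : girlOuter 0 = 0 := by
  unfold girlOuter
  simp (disch := norm_num) only [clamp_of_nonpos]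
  norm_num

theorem girlOuter_one : girlOuter 1 = 1 := by
  unfold girlOuter
  simp (disch := norm_num) only [clamp_of_one_le]
  norm_num

theorem girlInner_zero : girlInner 0 = 0 := by
  unfold girlInner
  simp (disch := norm_num) only [clamp_of_nonpos]
  norm_num

theorem girlInner_one : girlInner 1 = 1 := by
  unfold girlInner
  simp (disch := norm_num) only [clamp_of_one_le]
  norm_num

/-- The first pentagon enters reflected, since it reads `C'` backwards. The shift by `2 / 5` puts
the common vertex of the two free sides at `0`, so the collapsed arc does not wrap around. -/
theorem isCollapse_girlOuter : IsCollapse (fun s => periodize girlOuter (s + 2 / 5))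
    (fun _ : Unit => 1 / 5 - 2 / 5) (fun _ : Unit => 4 / 5 - 2 / 5) := by
  have hcl := continuous_clamp
  refine IsCollapse.comp_add (a := fun _ : Unit => (1 / 5 : ℝ)) (b := fun _ : Unit => (4 / 5 : ℝ))
    ?_ (2 / 5)
  refine isCollapse_periodize (by unfold girlOuter; fun_prop) ?_ girlOuter_zero girlOuter_one
    (fun _ => by norm_num) (fun _ => by norm_num) (fun _ => by norm_num) (fun _ => ?_) ?_
    (fun _ _ _ _ _ => rfl) (fun _ _ => Or.inl (by norm_num))
  · intro x y h
    unfold girlOuter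
    have e0 : clamp (5 * x) ≤ clamp (5 * y) := monotone_clamp (by linarith)
    have e4 : clamp (5 * x - 4) ≤ clamp (5 * y - 4) := monotone_clamp (by linarith)
    linarith
  · unfold girlOuter
    norm_num
    simp (disch := norm_num) only [clamp_of_one_le, clamp_of_nonpos]
  · intro x y hx hxy hy h
    unfold girlOuter at h
    have e0 : clamp (5 * x) ≤ clamp (5 * y) := monotone_clamp (by linarith)
    have e4 : clamp (5 * x - 4) ≤ clamp (5 * y - 4) := monotone_clamp (by linarith)
    have f0 := (of_clamp_eq (x := 5 * x) (y := 5 * y) (by linarith)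
      (by linarith)).resolve_left (by linarith)
    have f4 := (of_clamp_eq (x := 5 * x - 4) (y := 5 * y - 4) (by linarith)
      (by linarith)).resolve_right (by linarith)
    exact ⟨(), by linarith, by linarith⟩

/-- The free sides of the second pentagon read `C`, `B`, `A` backwards. The rotation by `-2 / 3`
makes them `A`, `C`, `B`, the order along the arc of the reflected first pentagon. -/
theorem isCollapse_girlInner : IsCollapse (fun s => periodize girlInner s + -(2 / 3))
    (arcStart 5 2) (arcEnd 5 2) := by
  have hcl := continuous_clamp
  refine IsCollapse.add_const ?_ _
  have hmono : ∀ k x y : ℝ, x ≤ y → clamp (5 * x - k) ≤ clamp (5 * y - k) :=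
    fun k x y h => monotone_clamp (by linarith)
  have hmono0 : ∀ x y : ℝ, x ≤ y → clamp (5 * x) ≤ clamp (5 * y) :=
    fun x y h => monotone_clamp (by linarith)
  refine isCollapse_arcs (by norm_num) (by norm_num) (by unfold girlInner; fun_prop) ?_
    girlInner_zero girlInner_one ?_ ?_
  · intro x y h
    unfold girlInner
    linarith [hmono0 x y h, hmono 2 x y h, hmono 3 x y h]
  · intro j
    unfold girlInner arcStart arcEnd
    fin_cases j <;> norm_num <;>
      simp (disch := norm_num) only [clamp_of_one_le, clamp_of_nonpos]
  · intro x y hx hxy hy h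
    unfold girlInner at h
    have e0 := hmono0 x y hxy.le
    have e2 := hmono 2 x y hxy.le
    have e3 := hmono 3 x y hxy.le
    have key : ∀ k : ℝ, clamp (5 * x - k) = clamp (5 * y - k) → 5 * y ≤ k ∨ k + 1 ≤ 5 * x := by
      intro k hk
      rcases of_clamp_eq (by linarith) hk with h' | h'
      · left; linarith
      · right; linarith
    have key0 : 5 * y ≤ 0 ∨ 1 ≤ 5 * x := of_clamp_eq (by linarith) (by linarith)
    have f0 : 1 ≤ 5 * x := key0.resolve_left (by linarith)
    rcases key 2 (by linarith) with g | f2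
    · exact ⟨0, by norm_num; linarith, by norm_num; linarith⟩
    have f3 := (key 3 (by linarith)).resolve_left (by linarith)
    exact ⟨1, by norm_num; linarith, by norm_num; linarith⟩

theorem girlInner_side (t : I) (k : ℕ) (y : ℝ) (h : (k, y) ∈ [(0, 0), (2, 1), (3, (2 : ℝ))]) :
    periodize girlInner ((k + t) / 5) = (y + t) / 3 := by
  have t0 := t.2.1
  have t1 := t.2.2
  have hk : (k : ℝ) ≤ 3 := by
    simp only [List.mem_cons, Prod.mk.injEq, List.not_mem_nil, or_false] at h
    have : k ≤ 3 := by omega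
    exact_mod_cast this
  have e := periodize_add_int girlInner_zero girlInner_one (x := (k + t) / 5) (by positivity)
    (by linarith) 0
  simp only [Int.cast_zero, add_zero] at e
  rw [e, girlInner]
  simp only [mul_div_cancel₀ _ (show (5 : ℝ) ≠ 0 by norm_num)]
  have e0 := clamp_side k 0 t
  have e2 := clamp_side k 2 t
  have e3 := clamp_side k 3 t
  push_cast at e0 e2 e3
  rw [sub_zero] at e0
  rw [e0, e2, e3]
  simp only [List.mem_cons, Prod.mk.injEq, List.not_mem_nil, or_false] at h
  rcases h with ⟨rfl, rfl⟩ | ⟨rfl, rfl⟩ | ⟨rfl, rfl⟩ <;> norm_num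

theorem girlOuter_side_one (t : I) : periodize girlOuter ((t - 2) / 5 + 2 / 5) = t / 2 := by
  have t0 := t.2.1
  have t1 := t.2.2
  have e := periodize_add_int girlOuter_zero girlOuter_one (x := t / 5) (by positivity)
    (by linarith) 0
  simp only [Int.cast_zero, add_zero] at e
  rw [show ((t : ℝ) - 2) / 5 + 2 / 5 = t / 5 by ring, e, girlOuter,
    mul_div_cancel₀ _ (show (5 : ℝ) ≠ 0 by norm_num), clamp_of_mem t0 t1,
    clamp_of_nonpos (by linarith), add_zero]

theorem girlOuter_side_two (t : I) :
    periodize girlOuter ((t - 3) / 5 + 2 / 5) = (1 + t) / 2 - 1 := by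
  have t0 := t.2.1
  have t1 := t.2.2
  have e := periodize_add_int girlOuter_zero girlOuter_one (x := (4 + t) / 5) (by positivity)
    (by linarith) (-1)
  rw [show ((t : ℝ) - 3) / 5 + 2 / 5 = (4 + t) / 5 + (-1 : ℤ) by push_cast; ring, e, girlOuter,
    mul_div_cancel₀ _ (show (5 : ℝ) ≠ 0 by norm_num), add_sub_cancel_left, clamp_of_mem t0 t1,
    clamp_of_one_le (by linarith)]
  push_cast; ring

/-- The map from the polygons of the Girl's surface to the disk. -/
noncomputable def girlModel (n n' : Disk → Disk) (p : Unit → Disk → Disk)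
    (p' : Fin 2 → Disk → Disk) (x : Polygons) : Disk :=
  match x with
  | ⟨0, z⟩ => p () (p' 0 z)
  | ⟨1, z⟩ => p () (p' 1 z)
  | ⟨2, z⟩ => n z.conj
  | ⟨3, z⟩ => p () (n' z)

/-- The images of the edges of the Girl's surface. -/
noncomputable def girlEdge (p : Unit → Disk → Disk) (p' : Fin 2 → Disk → Disk) (e : Edge) (t : I) :
    Disk :=
  match e with
  | .A => p () (Disk.turn ((1 - t) / 3))
  | .B => p () (Disk.turn ((3 - t) / 3))
  | .C => p () (Disk.turn ((2 - t) / 3))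
  | .A' => p () (p' 0 (Disk.turn t))
  | .B' => p () (p' 1 (Disk.turn t))
  | .C' => Disk.turn (t / 2)

section

variable {n n' : Disk → Disk} {p : Unit → Disk → Disk} {p' : Fin 2 → Disk → Disk}

theorem girlModel_side (h : IsPetalDecomposition (fun s => periodize girlOuter (s + 2 / 5))
    (fun _ : Unit => 1 / 5 - 2 / 5) (fun _ : Unit => 4 / 5 - 2 / 5) n p) (k : Fin 2) (t : I) :
    girlModel n n' p p' (girl.sidePoint 2 (girlSide k) t) =
      Disk.turn (((k : ℕ) + (t : ℝ)) / 2) := by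
  have t0 := t.2.1
  have t1 := t.2.2
  have hfree : ∀ s : ℝ, -(3 / 5) ≤ s → s ≤ -(1 / 5) →
      s ∉ openArcs (fun _ : Unit => (1 / 5 - 2 / 5 : ℝ)) (fun _ : Unit => 4 / 5 - 2 / 5) := by
    rintro s h1 h2 ⟨⟨⟩, m, h3, h4⟩
    dsimp only at h3 h4
    have e1 : (m : ℝ) < 0 := by linarith
    have e2 : (-1 : ℝ) < m := by linarith
    have e1' : m < 0 := by exact_mod_cast e1
    have e2' : -1 < m := by exact_mod_cast e2
    omega
  fin_cases k
  · refine (congrArg _ (Scheme.sidePoint_of_false 1 5 t rfl rfl rfl)).trans ?_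
    change n (Disk.turn _).conj = _
    rw [Disk.conj_turn]
    have e : -((((1 : ℕ) : ℝ) + (1 - t)) / (5 : ℕ)) = (t - 2) / 5 := by push_cast; ring
    rw [e, h.core_turn _ (hfree _ (by linarith) (by linarith)), girlOuter_side_one]
    simp
  · refine (congrArg _ (Scheme.sidePoint_of_false 2 5 t rfl rfl rfl)).trans ?_
    change n (Disk.turn _).conj = _
    rw [Disk.conj_turn]
    have e : -((((2 : ℕ) : ℝ) + (1 - t)) / (5 : ℕ)) = (t - 3) / 5 := by push_cast; ring
    rw [e, h.core_turn _ (hfree _ (by linarith) (by linarith)), girlOuter_side_two,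
      Disk.turn_eq_turn]
    exact ⟨-1, by norm_num; ring⟩

/-- The second pentagon and its monogons form a triangle inside the single outer petal. They are not
reflected: the second pentagon reads `A'` and `B'` forwards, and `A`, `B`, `C` backwards as the
reflected first one does. -/
theorem isModel_girl (h : IsPetalDecomposition (fun s => periodize girlOuter (s + 2 / 5))
    (fun _ : Unit => 1 / 5 - 2 / 5) (fun _ : Unit => 4 / 5 - 2 / 5) n p)
    (h' : IsPetalDecomposition (fun s => periodize girlInner s + -(2 / 3))
    (arcStart 5 2) (arcEnd 5 2) n' p') : IsModel girl girlGlued (girlModel n n' p p') := by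
  have hside := girlModel_side (n' := n') (p' := p') h
  have houter : ∀ (u : I) (s : ℝ) (m : ℤ), s = -(1 / 5) + 3 * u / 5 + m →
      n (Disk.turn s) = p () (Disk.turn u) := by
    rintro u s m rfl
    rw [← h.core_arc, Disk.turn_add_int]
    congr 2
    ring
  have hinner : ∀ (t : I) (k : ℕ) (y r : ℝ) (m : ℤ),
      (k, y) ∈ [(0, 0), (2, 1), (3, (2 : ℝ))] → r = (y + t) / 3 - 2 / 3 + m →
      n' (Disk.turn ((k + t) / (5 : ℕ))) = Disk.turn r := by
    rintro t k y r m hk rfl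
    rw [h'.core_turn, Disk.turn_add_int]
    · have := girlInner_side t k y hk
      push_cast
      rw [this, sub_eq_add_neg]
    · simp only [List.mem_cons, Prod.mk.injEq, List.not_mem_nil, or_false] at hk
      exact notMem_openArcs (N := 5) (m := 2) (by norm_num) k (by omega)
        (fun j hj => by omega) (by norm_num) t
  have hpetal : ∀ (j : Fin 2) (t : I) (k : ℕ), k = 3 * (j : ℕ) + 1 →
      n' (Disk.turn ((k + t) / (5 : ℕ))) = p' j (Disk.turn t) := by
    intro j t k hk
    rw [arcStart_add_mul_side j t k hk, h'.core_arc]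
  have hσ : ∀ t : I, (unitInterval.symm t : ℝ) = 1 - t := fun t => rfl
  refine IsModel.of_sides ?_ ?_ ?_ (girlEdge p p') ?_ ?_ ?_
  · refine continuous_sigma fun i => ?_
    fin_cases i
    · exact (h.continuous_petal ()).comp (h'.continuous_petal 0)
    · exact (h.continuous_petal ()).comp (h'.continuous_petal 1)
    · exact h.continuous_core.comp Disk.continuous_conj
    · exact (h.continuous_petal ()).comp h'.continuous_core
  · intro z
    rcases h.surjective z with ⟨x, rfl⟩ | ⟨⟨⟩, y, rfl⟩
    · exact ⟨⟨2, x.conj⟩, by simp [girlModel]⟩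
    · rcases h'.surjective y with ⟨x, rfl⟩ | ⟨j, y, rfl⟩
      · exact ⟨⟨3, x⟩, rfl⟩
      · fin_cases j
        · exact ⟨⟨0, y⟩, rfl⟩
        · exact ⟨⟨1, y⟩, rfl⟩
  · let mk := Scheme.Glued.mk girl girlGlued
    obtain ⟨G', hG'1, hG'2⟩ := h'.exists_desc (fun z => mk ⟨3, z⟩)
      (fun j z => mk ⟨(![0, 1] : Fin 2 → Fin 4) j, z⟩) (by
        intro j t
        have e : Disk.turn t = Disk.turn (((0 : ℕ) + (t : ℝ)) / (1 : ℕ)) := by simp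
        rw [e]
        fin_cases j
        · rw [← arcStart_add_mul_side _ t 1 rfl, ← Scheme.sidePoint_of_true (K := girl) (i := 3)
            (k := (1 : Fin 5)) 1 5 t rfl rfl rfl]
          refine Quot.sound ⟨3, (1 : Fin 5), 0, (0 : Fin 1), t, rfl, ?_, rfl, ?_⟩
          · simp [Scheme.edge, girl]
          · exact (Scheme.sidePoint_of_true 0 1 _ rfl rfl rfl).symm
        · rw [← arcStart_add_mul_side _ t 4 rfl, ← Scheme.sidePoint_of_true (K := girl) (i := 3)
            (k := (4 : Fin 5)) 4 5 t rfl rfl rfl]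
          refine Quot.sound ⟨3, (4 : Fin 5), 1, (0 : Fin 1), t, rfl, ?_, rfl, ?_⟩
          · simp [Scheme.edge, girl]
          · exact (Scheme.sidePoint_of_true 0 1 _ rfl rfl rfl).symm)
    obtain ⟨G, hG1, hG2⟩ := h.exists_desc (fun z => mk ⟨2, z.conj⟩) (fun _ => G') (by
        rintro ⟨⟩ u
        have key : ∀ (k l : Fin 5) (v : I) (r : ℝ) (m m' : ℤ) (y : ℝ),
            girl.edge 2 k = girl.edge 3 l → girl.edge 2 k ∈ girlGlued →
            ((girl 2).get k).2 = true → ((girl 3).get l).2 = false →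
            ((l : ℕ), y) ∈ [(0, 0), (2, 1), (3, (2 : ℝ))] →
            (u : ℝ) = (y + v) / 3 - 2 / 3 + m →
            -(1 / 5 - 2 / 5 + (4 / 5 - 2 / 5 - (1 / 5 - 2 / 5)) * (u : ℝ)) =
              ((k : ℕ) + (1 - v)) / (5 : ℕ) + m' →
            mk ⟨2, (Disk.turn (1 / 5 - 2 / 5 + (4 / 5 - 2 / 5 - (1 / 5 - 2 / 5)) *
              (u : ℝ))).conj⟩ = G' (Disk.turn u) := by
          intro k l v r m m' y hkl hk hkt hlf hy hu hu'
          rw [Disk.conj_turn, hu', Disk.turn_add_int, ← hinner v l y u m hy hu, hG'1]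
          refine Quot.sound ⟨2, k, 3, l, unitInterval.symm v, hkl, hk, ?_, ?_⟩
          · exact (Scheme.sidePoint_of_true (k : ℕ) 5 (unitInterval.symm v) hkt rfl rfl).symm
          · rw [Scheme.sidePoint_of_false (l : ℕ) 5 _ hlf rfl rfl, hσ, sub_sub_cancel]
        -- The thirds of the glued arc are the edges `A`, `C`, `B`: sides `0`, `4`, `3` of the first
        -- pentagon and `3`, `0`, `2` of the second. The integers undo full turns.
        obtain ⟨k, v, hu⟩ := exists_side (N := 3) (by norm_num) u
        fin_cases k
        · refine key 0 3 v u 0 0 2 rfl ?_ rfl rfl (by simp) ?_ ?_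
          · simp [Scheme.edge, girl]
          · rw [hu]; norm_num; ring
          · rw [hu]; norm_num; ring
        · refine key 4 0 v u 1 (-1) 0 rfl ?_ rfl rfl (by simp) ?_ ?_
          · simp [Scheme.edge, girl]
          · rw [hu]; norm_num; ring
          · rw [hu]; norm_num; ring
        · refine key 3 2 v u 1 (-1) 1 rfl ?_ rfl rfl (by simp) ?_ ?_
          · simp [Scheme.edge, girl]
          · rw [hu]; norm_num; ring
          · rw [hu]; norm_num; ring)
    have hG : ∀ x, G (girlModel n n' p p' x) = mk x := by
      rintro ⟨i, z⟩
      fin_cases i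
      · exact (hG2 () _).trans (hG'2 0 z)
      · exact (hG2 () _).trans (hG'2 1 z)
      · exact (hG1 _).trans (by simp)
      · exact (hG2 () _).trans (hG'1 z)
    intro x y hxy
    exact (hG x).symm.trans ((congrArg G hxy).trans (hG y))
  · intro i k t hk
    have hA : ∀ (u : I) (s : ℝ) (m : ℤ) (r : ℝ), r = u → -s = -(1 / 5) + 3 * u / 5 + m →
        n (Disk.turn s).conj = p () (Disk.turn r) := by
      rintro u s m _ rfl hs
      rw [Disk.conj_turn]
      exact houter u _ m hs
    have t0 := t.2.1
    have t1 := t.2.2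
    fin_cases i
    · obtain ⟨k, hk'⟩ := k
      obtain rfl : k = 0 := Nat.lt_one_iff.1 hk'
      rw [Scheme.sidePoint_of_true 0 1 t rfl rfl rfl]
      simp [girlModel, girlEdge, Scheme.edge, girl]
    · obtain ⟨k, hk'⟩ := k
      obtain rfl : k = 0 := Nat.lt_one_iff.1 hk'
      rw [Scheme.sidePoint_of_true 0 1 t rfl rfl rfl]
      simp [girlModel, girlEdge, Scheme.edge, girl]
    · change Fin 5 at k
      fin_cases k
      · refine (congrArg _ (Scheme.sidePoint_of_true 0 5 t rfl rfl rfl)).trans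
          (hA ⟨(1 - t) / 3, by linarith, by linarith⟩ _ 0 _ rfl ?_)
        norm_num; ring
      · exact absurd hk (by simp [Scheme.edge, girl])
      · exact absurd hk (by simp [Scheme.edge, girl])
      · refine (congrArg _ (Scheme.sidePoint_of_true 3 5 t rfl rfl rfl)).trans
          (hA ⟨(3 - t) / 3, by linarith, by linarith⟩ _ (-1) _ rfl ?_)
        norm_num; ring
      · refine (congrArg _ (Scheme.sidePoint_of_true 4 5 t rfl rfl rfl)).trans
          (hA ⟨(2 - t) / 3, by linarith, by linarith⟩ _ (-1) _ rfl ?_)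
        norm_num; ring
    · change Fin 5 at k
      fin_cases k
      · refine (congrArg _ (Scheme.sidePoint_of_false 0 5 t rfl rfl rfl)).trans
          (congrArg (p ()) (hinner (unitInterval.symm t) 0 0 _ 1 (by simp) ?_))
        rw [hσ]; norm_num; ring
      · exact (congrArg _ (Scheme.sidePoint_of_true 1 5 t rfl rfl rfl)).trans
          (congrArg (p ()) (hpetal 0 t 1 rfl))
      · refine (congrArg _ (Scheme.sidePoint_of_false 2 5 t rfl rfl rfl)).trans
          (congrArg (p ()) (hinner (unitInterval.symm t) 2 1 _ 1 (by simp) ?_))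
        rw [hσ]; norm_num; ring
      · refine (congrArg _ (Scheme.sidePoint_of_false 3 5 t rfl rfl rfl)).trans
          (congrArg (p ()) (hinner (unitInterval.symm t) 3 2 _ 0 (by simp) ?_))
        rw [hσ]; norm_num; ring
      · exact (congrArg _ (Scheme.sidePoint_of_true 4 5 t rfl rfl rfl)).trans
          (congrArg (p ()) (hpetal 1 t 4 rfl))
  · intro i k t hk
    fin_cases i
    · obtain ⟨k, hk'⟩ := k
      obtain rfl : k = 0 := Nat.lt_one_iff.1 hk'
      exact absurd hk (by simp [Scheme.edge, girl])
    · obtain ⟨k, hk'⟩ := k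
      obtain rfl : k = 0 := Nat.lt_one_iff.1 hk'
      exact absurd hk (by simp [Scheme.edge, girl])
    · change Fin 5 at k
      fin_cases k
      · exact absurd hk (by simp [Scheme.edge, girl])
      · exact Or.inl ((hside 0 t).trans (by simp [girlEdge, Scheme.edge, girl]))
      · refine (hside 1 t).symm ▸ Disk.antipodal_turn (s' := t / 2) ?_
        norm_num; ring
      · exact absurd hk (by simp [Scheme.edge, girl])
      · exact absurd hk (by simp [Scheme.edge, girl])
    · change Fin 5 at k
      fin_cases k <;> exact absurd hk (by simp [Scheme.edge, girl])
  · intro z hz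
    obtain ⟨s, rfl⟩ := Disk.exists_turn_unit hz
    obtain ⟨k, t, hs⟩ := exists_side (N := 2) (by norm_num) s
    have e : Disk.turn (((1 : ℕ) + (t : ℝ)) / 2) =
        Disk.turn (((0 : ℕ) + (t : ℝ)) / 2 + 1 / 2) := by
      congr 1
      push_cast; ring
    have e' := Disk.coe_turn_add_half (((0 : ℕ) + (t : ℝ)) / 2)
    rw [← e] at e'
    fin_cases k
    · refine ⟨_, _, (hside 0 t).trans ?_, (congrArg Subtype.val (hside 1 t)).trans ?_,
        2, girlSide 0, 2, girlSide 1, t, rfl, mem_univ _, rfl, rfl⟩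
      · rw [hs]; norm_num
      · rw [hs]
        exact e'
    · refine ⟨_, _, (hside 1 t).trans ?_, (congrArg Subtype.val (hside 0 t)).trans ?_,
        2, girlSide 1, 2, girlSide 0, t, rfl, mem_univ _, rfl, rfl⟩
      · rw [hs]; norm_num
      · rw [hs]
        exact (neg_eq_iff_eq_neg.2 e').symm

/-- In the Girl's surface, a curve in the 1-skeleton that does not separate the projective plane
consists of the edge `C'`. -/
theorem girl_boundary_subset
    (h : IsPetalDecomposition (fun s => periodize girlOuter (s + 2 / 5))
    (fun _ : Unit => 1 / 5 - 2 / 5) (fun _ : Unit => 4 / 5 - 2 / 5) n p)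
    (h' : IsPetalDecomposition (fun s => periodize girlInner s + -(2 / 3))
    (arcStart 5 2) (arcEnd 5 2) n' p') {P : Type*} [TopologicalSpace P] {q₀ q : Disk → P}
    (h₀ : IsAntipodalQuotient q₀) (hq : IsAntipodalQuotient q)
    (hcurve : ∀ z : Disk, ‖(z : ℂ)‖ = 1 →
      ∃ x : Polygons, ‖(x.2 : ℂ)‖ = 1 ∧ q z = q₀ (girlModel n n' p p' x))
    (z : Disk) (hz : ‖(z : ℂ)‖ = 1) : ∃ w : Disk, ‖(w : ℂ)‖ = 1 ∧ q z = q₀ w := by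
  -- The loops `A'` and `B'` are excluded first, inside the outer petal; the core `range n` is the
  -- outside.
  have hinner := h'.boundary_subset isCollapse_girlInner h₀ hq (e := p ())
    (N := range n) (h.continuous_petal ()) (h.petal_injective ())
    (isCompact_range h.continuous_core).isClosed (fun x => by
      rcases h.surjective x with hx | ⟨⟨⟩, y, hy⟩
      · exact Or.inl hx
      · exact Or.inr ⟨y, hy⟩) (by
      rintro y ⟨x, hx⟩
      obtain ⟨t, -, rfl⟩ := h.core_eq_petal _ _ _ hx
      exact Disk.norm_turn _) (fun y hy => by
      rw [h.petal_boundary () y hy, Disk.norm_turn]) (by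
      intro z hz
      obtain ⟨⟨i, x⟩, hx, hx'⟩ := hcurve z hz
      refine ⟨_, hx', ?_⟩
      fin_cases i
      · exact Or.inr ⟨_, rfl, Or.inr ⟨0, x, hx, rfl⟩⟩
      · exact Or.inr ⟨_, rfl, Or.inr ⟨1, x, hx, rfl⟩⟩
      · rcases h.core_boundary (x := x.conj) (by rw [Disk.norm_conj]; exact hx) with
          h1 | ⟨⟨⟩, y, hy, hy'⟩
        · exact Or.inl h1
        · exact Or.inr ⟨y, hy', Or.inl hy⟩
      · exact Or.inr ⟨_, rfl, h'.core_boundary hx⟩)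
  -- What remains is the unit circle and the boundary of the outer petal, which is excluded in turn.
  obtain ⟨x, hx, hx' | ⟨_, rfl, hw⟩⟩ := h.boundary_subset isCollapse_girlOuter h₀ hq (e := id)
    (N := ∅) continuous_id Function.injective_id isClosed_empty (fun x => Or.inr ⟨x, rfl⟩)
    (fun y hy => hy.elim) (fun y hy => hy) (by
      intro z hz
      obtain ⟨x, hx, hx' | ⟨w, hw, hw'⟩⟩ := hinner z hz
      · exact ⟨x, hx, Or.inl hx'⟩
      · exact ⟨x, hx, Or.inr ⟨x, rfl, Or.inr ⟨(), w, hw', hw⟩⟩⟩) z hz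
  · exact ⟨x, hx', hx⟩
  · exact ⟨_, hw, hx⟩

end

end TripleImmersion

/-! ### Assembly of the two cases -/

theorem lemma1 {P S : Type*} [TopologicalSpace P] [TopologicalSpace S] (f : P → S) :
    (∀ c : TripleImmersion.CellStructure TripleImmersion.boy f,
      ∃ φ : TripleImmersion.Disk ≃ₜ
          TripleImmersion.boy.Glued TripleImmersion.boyGlued,
        (∀ (k : Fin 6) (t : unitInterval),
          φ (TripleImmersion.Disk.turn (((k : ℕ) + (t : ℝ)) / 6)) =
            TripleImmersion.Scheme.Glued.mk TripleImmersion.boy TripleImmersion.boyGlued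
              (TripleImmersion.boy.sidePoint 3 (TripleImmersion.boySide k) t)) ∧
        c.IsRepresentation (c.proj TripleImmersion.boyGlued ∘ φ) ∧
        ∀ q : TripleImmersion.Disk → P, c.IsRepresentation q →
          ∃ h : TripleImmersion.Disk ≃ₜ TripleImmersion.Disk,
            q = (c.proj TripleImmersion.boyGlued ∘ φ) ∘ h) ∧
    (∀ c : TripleImmersion.CellStructure TripleImmersion.girl f,
      ∃ φ : TripleImmersion.Disk ≃ₜ
          TripleImmersion.girl.Glued TripleImmersion.girlGlued,
        (∀ (k : Fin 2) (t : unitInterval),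
          φ (TripleImmersion.Disk.turn (((k : ℕ) + (t : ℝ)) / 2)) =
            TripleImmersion.Scheme.Glued.mk TripleImmersion.girl TripleImmersion.girlGlued
              (TripleImmersion.girl.sidePoint 2 (TripleImmersion.girlSide k) t)) ∧
        c.IsRepresentation (c.proj TripleImmersion.girlGlued ∘ φ) ∧
        ∀ q : TripleImmersion.Disk → P, c.IsRepresentation q →
          ∃ h : TripleImmersion.Disk ≃ₜ TripleImmersion.Disk,
            q = (c.proj TripleImmersion.girlGlued ∘ φ) ∘ h) := by
  refine ⟨fun c => ?_, fun c => ?_⟩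
  · obtain ⟨n, p, h⟩ := TripleImmersion.isCollapse_boy.exists_isPetalDecomposition
    have hM := TripleImmersion.isModel_boy h
    obtain ⟨φ, hφ⟩ := hM.exists_homeomorph
    refine ⟨φ, fun k t => ?_, hM.isRepresentation c φ hφ,
      hM.exists_homeomorph_eq c φ hφ fun q₀ q => TripleImmersion.boy_boundary_subset h⟩
    rw [← TripleImmersion.boyModel_side h, hφ]
  · obtain ⟨n, p, h⟩ := TripleImmersion.isCollapse_girlOuter.exists_isPetalDecomposition
    obtain ⟨n', p', h'⟩ := TripleImmersion.isCollapse_girlInner.exists_isPetalDecomposition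
    have hM := TripleImmersion.isModel_girl h h'
    obtain ⟨φ, hφ⟩ := hM.exists_homeomorph
    refine ⟨φ, fun k t => ?_, hM.isRepresentation c φ hφ,
      hM.exists_homeomorph_eq c φ hφ fun q₀ q => TripleImmersion.girl_boundary_subset h h'⟩
    rw [← TripleImmersion.girlModel_side (n' := n') (p' := p') h, hφ]
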